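/- Let $\Sigma$ be a closed connected surface, for example the closed orientable surface $\Sigma_g$ of genus $g\ge 0$. A link projection on $\Sigma$ with $n$ components is a (locally flat) closed multi-curve $\bigsqcup_{i=1}^n S^1\to\Sigma$ whose only singularities are finitely many transverse double points, called crossings. A link diagram $L$ is a link projection together with over/under information at each crossing; its regions are the connected components of the complement of the projection. The modified incidence matrix $M_L$ over $\mathbb{Z}_2$ has one row for each region and one column for each crossing; its entry at $(R,C)$ is, modulo $2$, the number (between $0$ and $4$) of the four corners at $C$ that are filled by $R$. Then the number $r(L)$ of regions is finite, and if $L'$ is obtained from $L$ by one of the three Reidemeister moves $\Omega_1,\Omega_2,\Omega_3$, performed inside a disc on $\Sigma$, then $$r(L)-\operatorname{rank}_{\mathbb{Z}_2}(M_L)=r(L')-\operatorname{rank}_{\mathbb{Z}_2}(M_{L'}).$$ Moreover, the same equality holds whenever $L$ and $L'$ are link diagrams on $\Sigma$ with the same number of components whose projections are freely homotopic as maps $\bigsqcup_{i=1}^n S^1\to\Sigma$, up to a homeomorphism of $\bigsqcup_{i=1}^n S^1$ (that is, irrespective of the numbering and parametrization of the components). -/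

import Mathlib

open Set Topology

/-- The domain of an `n`-component link projection: the disjoint union of `n` circles. -/
abbrev Circles (n : ℕ) : Type := Fin n × Circle

/-- `e` is a coordinate plane around `p` in which `A` is the horizontal axis. -/
def IsArcChart {X : Type*} [TopologicalSpace X] (A : Set X) (p : X) (e : ℝ × ℝ → X) : Prop :=
  IsOpenEmbedding e ∧ e 0 = p ∧ e ⁻¹' A = {q | q.2 = 0}

/-- `e` is a coordinate plane around `p` in which `A` is the union of the two axes. -/
def IsCrossChart {X : Type*} [TopologicalSpace X] (A : Set X) (p : X) (e : ℝ × ℝ → X) : Prop :=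
  IsOpenEmbedding e ∧ e 0 = p ∧ e ⁻¹' A = {q | q.1 = 0 ∨ q.2 = 0}

/-- A link projection with `n` components on the surface `X`: a generic (locally flat) closed
multi-curve, whose only singularities are finitely many transverse double points. -/
structure LinkProjection (n : ℕ) (X : Type*) [TopologicalSpace X] where
  curve : C(Circles n, X)
  /-- Away from the double points the image is locally a flat arc. -/
  regular : ∀ z, (∀ w, curve w = curve z → w = z) →
    ∃ e, IsArcChart (range curve) (curve z) e
  /-- No point of the surface is hit more than twice. -/
  double : ∀ z w v, curve z = curve w → curve w = curve v → z = w ∨ w = v ∨ z = v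
  /-- At a double point the two strands cross each other like the two axes of the plane. -/
  transverse : ∀ z w, z ≠ w → curve z = curve w →
    ∃ e, IsCrossChart (range curve) (curve z) e ∧
      (∀ᶠ v in 𝓝 z, curve v ∈ e '' {q | q.2 = 0}) ∧
      (∀ᶠ v in 𝓝 w, curve v ∈ e '' {q | q.1 = 0})
  finite_double : {p | ∃ z w, z ≠ w ∧ curve z = p ∧ curve w = p}.Finite

namespace LinkProjection

variable {n : ℕ} {X : Type*} [TopologicalSpace X]

/-- The crossing points. -/
def Crossing (P : LinkProjection n X) : Type _ :=
  {p : X // ∃ z w, z ≠ w ∧ P.curve z = p ∧ P.curve w = p}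

noncomputable instance (P : LinkProjection n X) : Fintype P.Crossing :=
  P.finite_double.fintype

/-- The regions: the connected components of the complement of the projection. -/
def Region (P : LinkProjection n X) : Type _ :=
  ConnectedComponents {x : X // x ∉ range P.curve}

theorem exists_crossChart (P : LinkProjection n X) (c : P.Crossing) :
    ∃ e, IsCrossChart (range P.curve) c.1 e := by
  obtain ⟨p, z, w, hzw, hz, hw⟩ := c
  obtain ⟨e, he, -⟩ := P.transverse z w hzw (hz.trans hw.symm)
  exact ⟨e, hz ▸ he⟩

/-- A coordinate plane around a crossing in which the projection is the union of the two axes;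
nothing below depends on which one is taken. -/
noncomputable def crossChart (P : LinkProjection n X) (c : P.Crossing) : ℝ × ℝ → X :=
  Classical.choose (P.exists_crossChart c)

theorem crossChart_spec (P : LinkProjection n X) (c : P.Crossing) :
    IsCrossChart (range P.curve) c.1 (P.crossChart c) :=
  Classical.choose_spec (P.exists_crossChart c)

/-- The point `(±1, ±1)`, one in each of the four open quadrants. -/
noncomputable def quadrantPoint (s : Bool × Bool) : ℝ × ℝ :=
  (if s.1 then 1 else -1, if s.2 then 1 else -1)

theorem crossChart_quadrantPoint_notMem (P : LinkProjection n X) (c : P.Crossing)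
    (s : Bool × Bool) : P.crossChart c (quadrantPoint s) ∉ range P.curve := by
  intro h
  have h' : quadrantPoint s ∈ {q : ℝ × ℝ | q.1 = 0 ∨ q.2 = 0} :=
    (P.crossChart_spec c).2.2 ▸ h
  rcases s with ⟨a, b⟩
  cases a <;> cases b <;> norm_num [quadrantPoint] at h'

/-- The region that fills the given one of the four corners at the crossing `c`. (An open quadrant
of the coordinate plane is connected and misses the projection, so it lies in one region.) -/
noncomputable def cornerRegion (P : LinkProjection n X) (c : P.Crossing) (s : Bool × Bool) :
    P.Region :=
  ConnectedComponents.mk ⟨P.crossChart c (quadrantPoint s), P.crossChart_quadrantPoint_notMem c s⟩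

/-- The modified incidence matrix: the entry at `(R, c)` is, mod 2, the number of times the
region `R` appears around the crossing `c`. -/
noncomputable def incidenceMatrix (P : LinkProjection n X) :
    Matrix P.Region P.Crossing (ZMod 2) :=
  fun R c => (Nat.card {s : Bool × Bool // P.cornerRegion c s = R} : ZMod 2)

/-- The number of regions minus the rank of the modified incidence matrix over `ℤ/2`. -/
noncomputable def regionDefect (P : LinkProjection n X) : ℤ :=
  (Nat.card P.Region : ℤ) - (P.incidenceMatrix.rank : ℤ)

/-- Free homotopy of projections, as maps from a disjoint union of circles; the numbering and the
parametrizations of the components are disregarded. -/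
def Homotopic (P Q : LinkProjection n X) : Prop :=
  ∃ h : Circles n ≃ₜ Circles n, P.curve.Homotopic (Q.curve.comp (h : C(Circles n, Circles n)))

end LinkProjection

/-- A link diagram: a link projection with over/under information at every crossing. The set
`upper` consists of the parameters at which a strand passes over another one. -/
structure LinkDiagram (n : ℕ) (X : Type*) [TopologicalSpace X] extends LinkProjection n X where
  upper : Set (Circles n)
  upper_double : ∀ z ∈ upper, ∃ w, z ≠ w ∧ curve z = curve w
  upper_iff : ∀ z w, z ≠ w → curve z = curve w → (z ∈ upper ↔ w ∉ upper)

namespace LinkDiagram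

variable {n : ℕ} {X : Type*} [TopologicalSpace X]

/-- `L'` arises from `L` by replacing, inside a disc on the surface (the image under `e` of the
square `[-1, 1]²`), the tangle with strands `T i` by the tangle with strands `T' i`, `i < k`, both
parametrized by `[-1, 1]`. The diagrams agree outside the disc, and the strands inside it lie at
different heights `ht i`, the same before and after, which determine the over/under information at
the crossings of different strands. The parametrizations of the diagrams are matched by `h`, and
`a i` is the part of the link that runs along the `i`-th strand. -/
def LocalMove {k : ℕ} (T T' : Fin k → ℝ → ℝ × ℝ) (L L' : LinkDiagram n X) : Prop :=
  ∃ (e : ℝ × ℝ → X) (h : Circles n ≃ₜ Circles n) (a : Fin k → C(Icc (-1 : ℝ) 1, Circles n))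
    (ht : Fin k → ℕ),
    IsOpenEmbedding e ∧
    Function.Injective (fun p : Fin k × Icc (-1 : ℝ) 1 => a p.1 p.2) ∧
    Function.Injective ht ∧
    -- inside the disc
    (∀ z, L.curve z ∈ e '' (Icc (-1) 1 ×ˢ Icc (-1) 1) ↔ ∃ i u, a i u = z) ∧
    (∀ z, L'.curve (h z) ∈ e '' (Icc (-1) 1 ×ˢ Icc (-1) 1) ↔ ∃ i u, a i u = z) ∧
    (∀ i u, L.curve (a i u) = e (T i u)) ∧
    (∀ i u, L'.curve (h (a i u)) = e (T' i u)) ∧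
    (∀ i j u v, i ≠ j → L.curve (a i u) = L.curve (a j v) →
      (a i u ∈ L.upper ↔ ht j < ht i)) ∧
    (∀ i j u v, i ≠ j → L'.curve (h (a i u)) = L'.curve (h (a j v)) →
      (h (a i u) ∈ L'.upper ↔ ht j < ht i)) ∧
    -- outside the disc
    (∀ z, (¬ ∃ i u, a i u = z) → L'.curve (h z) = L.curve z ∧ (h z ∈ L'.upper ↔ z ∈ L.upper))

/-- The first Reidemeister move: a straight strand gets a kink. The kink crosses itself once, at
the parameters `±1/√2`. -/
def ReidemeisterOne (L L' : LinkDiagram n X) : Prop :=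
  LocalMove ![fun u => (u, 0)] ![fun u => (2 * u ^ 3 - u, (1 - u ^ 2) / 2)] L L'

/-- The second Reidemeister move: two parallel strands are pushed over each other. They then cross
twice, at the parameters `±1/√3`. -/
def ReidemeisterTwo (L L' : LinkDiagram n X) : Prop :=
  LocalMove ![fun u => (u, 1 / 2), fun u => (u, -(1 / 2))]
    ![fun u => (u, (3 * u ^ 2 - 1) / 4), fun u => (u, (1 - 3 * u ^ 2) / 4)] L L'

/-- The third Reidemeister move: a strand is pushed from one side of the crossing of two other
strands to the opposite side. -/
def ReidemeisterThree (L L' : LinkDiagram n X) : Prop :=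
  LocalMove
    ![fun u => (u, u / 2), fun u => (u, -(u / 2)), fun u => ((u ^ 2 - 1) / 2, u)]
    ![fun u => (u, u / 2), fun u => (u, -(u / 2)), fun u => ((1 - u ^ 2) / 2, u)] L L'

end LinkDiagram

/-! By rank-nullity for the transposed matrix, the number of regions minus the rank is the dimension
of the space of `ZMod 2`-valued functions on the regions whose values at the four corners of each
crossing add up to zero (`regionDefect_eq`). At one crossing this condition says that the jump of
the function across a strand is the same before and after the crossing (`sum_corners_eq_zero_iff`).
So the space consists of the functions whose jump is constant along each component.

Recording these jumps gives a linear map to `Fin n → ZMod 2`. Its kernel is the line of constant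
functions, because the surface is connected. Its image consists of the coefficients `j` for which
the combination of components with coefficients `j` bounds mod 2, that is, of the linear relations
between the mod 2 homology classes of the components. Hence the defect is one more than the
dimension of the space of relations (`finrank_evenSpace`). Homotopic curves have equal classes, and
each Reidemeister move is a homotopy inside a disc.

Homology enters in a dual form. A family `a` of local potentials attaches to each point `x` a
function `a x` that matters only near `x`, up to constants and nowhere dense sets. A curve is
represented by the indicator function of one of its sides at its own points, and by zero elsewhere.
`DualClass` is the quotient by the families that integrate to one function off a finite set. Short
arcs have classes too; they ramify at the endpoints. The three sides of a triangle in a coordinate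
plane cancel (`IsEdge.triangle`), so `edgeClass` satisfies a local cocycle relation. Pulled back
along a homotopy it can be integrated over the plane (`exists_lift_edgeClass`). The class of a
component is a period of this integral (`period_eq`), and the period does not change with time
(`componentPotential_homotopic`). -/

open Filter

/-! ### Local potentials -/

section Potentials

set_option linter.unusedSectionVars false

variable {X : Type*} [TopologicalSpace X] {G : Type*} [AddCommGroup G] {ℓ : Filter X}

/-- The filter of sets with dense interior. -/
def denseInterior (X : Type*) [TopologicalSpace X] : Filter X where
  sets := {s | Dense (interior s)}
  univ_sets := by simp
  sets_of_superset h hst := h.mono (interior_mono hst)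
  inter_sets hs ht := by
    simp only [mem_ofPred_eq, interior_inter] at *
    exact hs.inter_of_isOpen_left ht isOpen_interior

theorem mem_denseInterior {s : Set X} : s ∈ denseInterior X ↔ Dense (interior s) := Iff.rfl

/-- A filter for which holding almost everywhere is a local notion, and never a vacuous one. -/
structure IsLocalFilter (ℓ : Filter X) : Prop where
  neBot : ∀ x, (𝓝 x ⊓ ℓ).NeBot
  of_forall : ∀ (O : Set X) (p : X → Prop), IsOpen O → (∀ x ∈ O, ∀ᶠ y in 𝓝 x ⊓ ℓ, p y) →
    ∀ᶠ y in ℓ, y ∈ O → p y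

theorem isLocalFilter_top : IsLocalFilter (⊤ : Filter X) where
  neBot x := by rw [inf_top_eq]; infer_instance
  of_forall O s _ h := by
    refine eventually_top.2 fun y hy => ?_
    have := h y hy
    rw [inf_top_eq] at this
    exact this.self_of_nhds

theorem eventually_nhds_inf_denseInterior {x : X} {s : Set X} :
    (∀ᶠ y in 𝓝 x ⊓ denseInterior X, y ∈ s) ↔
      ∃ U D, IsOpen U ∧ x ∈ U ∧ IsOpen D ∧ Dense D ∧ U ∩ D ⊆ s := by
  constructor
  · intro h
    obtain ⟨u, hu, v, hv, h⟩ := mem_inf_iff_superset.1 h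
    obtain ⟨U, hU, hUo, hx⟩ := mem_nhds_iff.1 hu
    exact ⟨U, interior v, hUo, hx, isOpen_interior, hv,
      (inter_subset_inter hU interior_subset).trans h⟩
  · rintro ⟨U, D, hU, hx, hD, hDd, h⟩
    exact mem_inf_iff_superset.2 ⟨U, hU.mem_nhds hx, D,
      by rwa [mem_denseInterior, hD.interior_eq], h⟩

/-- Density can be tested in small open sets, and a nonempty open set meets a dense open set in a
nonempty open set. Curves are nowhere dense, so this filter ignores the values of a function on
them. -/
theorem isLocalFilter_denseInterior : IsLocalFilter (denseInterior X) where
  neBot x := by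
    refine ⟨fun h => ?_⟩
    have h' : ∀ᶠ y in 𝓝 x ⊓ denseInterior X, y ∈ (∅ : Set X) := by simp [h]
    obtain ⟨U, D, hU, hx, hD, hDd, h⟩ := eventually_nhds_inf_denseInterior.1 h'
    obtain ⟨y, hy⟩ := hDd.inter_open_nonempty U hU ⟨x, hx⟩
    exact h hy
  of_forall O s hO h := by
    change Dense (interior {y | y ∈ O → s y})
    rw [dense_iff_inter_open]
    intro W hW hWn
    by_cases hWO : (W ∩ O).Nonempty
    · obtain ⟨x, hxW, hxO⟩ := hWO
      obtain ⟨U, D, hU, hx, hD, hDd, hs⟩ := eventually_nhds_inf_denseInterior.1 (h x hxO)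
      obtain ⟨y, hy, hyD⟩ := hDd.inter_open_nonempty (W ∩ U) (hW.inter hU) ⟨x, hxW, hx⟩
      refine ⟨y, hy.1, mem_interior.2 ⟨U ∩ D, fun z hz _ => hs hz, hU.inter hD, hy.2, hyD⟩⟩
    · obtain ⟨x, hx⟩ := hWn
      exact ⟨x, hx, mem_interior.2 ⟨W, fun z hz hzO => (hWO ⟨z, hz, hzO⟩).elim, hW, hx⟩⟩

/-- Near `x` the function `h` is constant almost everywhere. -/
def EvConst (ℓ : Filter X) (x : X) (h : X → G) : Prop := ∃ c, ∀ᶠ y in 𝓝 x ⊓ ℓ, h y = c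

theorem eventually_nhds_eventually_inf {x : X} {p : X → Prop} (h : ∀ᶠ y in 𝓝 x ⊓ ℓ, p y) :
    ∀ᶠ z in 𝓝 x, ∀ᶠ y in 𝓝 z ⊓ ℓ, p y := by
  obtain ⟨u, hu, v, hv, h⟩ := mem_inf_iff_superset.1 h
  filter_upwards [eventually_mem_nhds_iff.2 hu] with z hz
  exact mem_inf_iff_superset.2 ⟨u, hz, v, hv, h⟩

namespace EvConst

variable {x : X} {f g : X → G}

theorem const (c : G) : EvConst ℓ x fun _ => c := ⟨c, .of_forall fun _ => rfl⟩

theorem zero : EvConst ℓ x (0 : X → G) := const 0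

theorem add (hf : EvConst ℓ x f) (hg : EvConst ℓ x g) : EvConst ℓ x (f + g) := by
  obtain ⟨c, hc⟩ := hf
  obtain ⟨d, hd⟩ := hg
  exact ⟨c + d, by filter_upwards [hc, hd] with y h h' using by simp [h, h']⟩

theorem neg (hf : EvConst ℓ x f) : EvConst ℓ x (-f) := by
  obtain ⟨c, hc⟩ := hf
  exact ⟨-c, by filter_upwards [hc] with y h using by simp [h]⟩

theorem sub (hf : EvConst ℓ x f) (hg : EvConst ℓ x g) : EvConst ℓ x (f - g) := by
  rw [sub_eq_add_neg]; exact hf.add hg.neg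

theorem sub_comm (h : EvConst ℓ x (f - g)) : EvConst ℓ x (g - f) := by
  simpa using h.neg

theorem trans {k : X → G} (h : EvConst ℓ x (f - g)) (h' : EvConst ℓ x (g - k)) :
    EvConst ℓ x (f - k) := by
  simpa using h.add h'

theorem congr (hf : EvConst ℓ x f) (h : ∀ᶠ y in 𝓝 x ⊓ ℓ, f y = g y) : EvConst ℓ x g := by
  obtain ⟨c, hc⟩ := hf
  exact ⟨c, by filter_upwards [hc, h] with y h h' using h' ▸ h⟩

theorem eventually (hf : EvConst ℓ x f) : ∀ᶠ z in 𝓝 x, EvConst ℓ z f := by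
  obtain ⟨c, hc⟩ := hf
  filter_upwards [eventually_nhds_eventually_inf hc] with z hz using ⟨c, hz⟩

end EvConst

theorem IsLocalFilter.const_unique (hℓ : IsLocalFilter ℓ) {x : X} {h : X → G} {c d : G}
    (hc : ∀ᶠ y in 𝓝 x ⊓ ℓ, h y = c) (hd : ∀ᶠ y in 𝓝 x ⊓ ℓ, h y = d) : c = d := by
  have := hℓ.neBot x
  obtain ⟨y, hy, hy'⟩ := (hc.and hd).exists
  exact hy.symm.trans hy'

/-- The constant near a point is unique because the filter is never vacuous. As a function of the
point it is locally constant, hence constant on a preconnected set. -/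
theorem IsLocalFilter.exists_const (hℓ : IsLocalFilter ℓ) {O : Set X} (hO : IsPreconnected O)
    {h : X → G} (hh : ∀ x ∈ O, EvConst ℓ x h) :
    ∃ c, ∀ x ∈ O, ∀ᶠ y in 𝓝 x ⊓ ℓ, h y = c := by
  classical
  rcases O.eq_empty_or_nonempty with rfl | ⟨x₀, hx₀⟩
  · exact ⟨0, by simp⟩
  let c : X → G := fun x => if hx : EvConst ℓ x h then hx.choose else 0
  have hc : ∀ x ∈ O, ∀ᶠ y in 𝓝 x ⊓ ℓ, h y = c x := fun x hx => by
    simp only [c, dif_pos (hh x hx)]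
    exact (hh x hx).choose_spec
  let _ : TopologicalSpace G := ⊥
  have : DiscreteTopology G := ⟨rfl⟩
  have hcont : ContinuousOn c O := by
    intro x hx
    refine tendsto_nhds_of_eventually_eq ?_
    filter_upwards [nhdsWithin_le_nhds (eventually_nhds_eventually_inf (hc x hx)),
      self_mem_nhdsWithin] with z hz hzO
    exact hℓ.const_unique (hc z hzO) hz
  refine ⟨c x₀, fun x hx => ?_⟩
  rw [hO.constant hcont hx₀ hx]
  exact hc x hx

/-- The local potentials `a` differ by constants near `x`. -/
def Coherent (ℓ : Filter X) (a : X → X → G) (x : X) : Prop :=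
  ∀ᶠ y in 𝓝 x, EvConst ℓ y (a x - a y)

/-- The local potentials `a` come from a function on `O`. -/
def HasPotential (ℓ : Filter X) (a : X → X → G) (O : Set X) : Prop :=
  ∃ f : X → G, ∀ x ∈ O, EvConst ℓ x (f - a x)

theorem HasPotential.mono {a : X → X → G} {O O' : Set X} (h : HasPotential ℓ a O) (hO : O' ⊆ O) :
    HasPotential ℓ a O' :=
  h.imp fun _ hf x hx => hf x (hO hx)

theorem Coherent.add {a b : X → X → G} {x : X} (ha : Coherent ℓ a x) (hb : Coherent ℓ b x) :
    Coherent ℓ (a + b) x := by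
  filter_upwards [ha, hb] with y h h'
  simpa [add_sub_add_comm] using h.add h'

theorem Coherent.hasPotential {a : X → X → G} {x : X} (h : Coherent ℓ a x) :
    ∃ U ∈ 𝓝 x, HasPotential ℓ a U :=
  ⟨_, h, a x, fun _ hy => hy⟩

theorem HasPotential.glue_of_const (hℓ : IsLocalFilter ℓ) {a : X → X → G} {O₁ O₂ : Set X}
    (h₁ : IsOpen O₁) (h₂ : IsOpen O₂) {f₁ f₂ : X → G} {c : G}
    (hf₁ : ∀ x ∈ O₁, EvConst ℓ x (f₁ - a x)) (hf₂ : ∀ x ∈ O₂, EvConst ℓ x (f₂ - a x))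
    (hc : ∀ x ∈ O₁ ∩ O₂, ∀ᶠ y in 𝓝 x ⊓ ℓ, (f₁ - f₂) y = c) :
    HasPotential ℓ a (O₁ ∪ O₂) := by
  classical
  -- At a point of `O₂` on the boundary of `O₁` the glued function switches between its two
  -- formulas, although the hypothesis says nothing there. Locality of `ℓ` turns the local
  -- equalities on the overlap into one that holds almost everywhere.
  have key := hℓ.of_forall _ _ (h₁.inter h₂) hc
  refine ⟨fun y => if y ∈ O₁ then f₁ y else f₂ y + c, fun x hx => ?_⟩
  by_cases hx₁ : x ∈ O₁
  · refine (hf₁ x hx₁).congr ?_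
    filter_upwards [mem_inf_of_left (h₁.mem_nhds hx₁)] with y hy
    simp [hy]
  · have hx₂ := hx.resolve_left hx₁
    refine ((hf₂ x hx₂).add (.const c)).congr ?_
    filter_upwards [mem_inf_of_left (h₂.mem_nhds hx₂), mem_inf_of_right key] with y hy hy'
    by_cases hy₁ : y ∈ O₁
    · have : f₁ y - f₂ y = c := hy' ⟨hy₁, hy⟩
      simp only [Pi.add_apply, Pi.sub_apply, hy₁, if_true, ← this]
      abel
    · simp only [Pi.add_apply, Pi.sub_apply, hy₁, if_false]
      abel

theorem HasPotential.glue (hℓ : IsLocalFilter ℓ) {a : X → X → G} {O₁ O₂ : Set X}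
    (h₁ : IsOpen O₁) (h₂ : IsOpen O₂) (hO : IsPreconnected (O₁ ∩ O₂))
    (hf₁ : HasPotential ℓ a O₁) (hf₂ : HasPotential ℓ a O₂) : HasPotential ℓ a (O₁ ∪ O₂) := by
  obtain ⟨f₁, hf₁⟩ := hf₁
  obtain ⟨f₂, hf₂⟩ := hf₂
  obtain ⟨c, hc⟩ := hℓ.exists_const hO (h := f₁ - f₂) fun x hx => by
    simpa using (hf₁ x hx.1).sub (hf₂ x hx.2)
  exact glue_of_const hℓ h₁ h₂ hf₁ hf₂ hc

theorem HasPotential.iUnion (hℓ : IsLocalFilter ℓ) {a : X → X → G} {O : ℕ → Set X}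
    (ho : ∀ k, IsOpen (O k)) (hc : ∀ k, IsPreconnected (O k)) (hm : Monotone O) {x₀ : X}
    (hx₀ : x₀ ∈ O 0) (hf : ∀ k, HasPotential ℓ a (O k)) : HasPotential ℓ a (⋃ k, O k) := by
  classical
  choose f hf using hf
  have hdiff : ∀ k m, k ≤ m → ∃ c, ∀ x ∈ O k, ∀ᶠ y in 𝓝 x ⊓ ℓ, (f k - f m) y = c :=
    fun k m hkm => hℓ.exists_const (hc k) fun x hx => by
      simpa using (hf k x hx).sub (hf m x (hm hkm hx))
  -- The constants compare each `f k` with `f 0` on `O 0`; after adding them, the functions `f k + c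
  -- k` agree on overlaps.
  choose c hcc using fun k => hdiff 0 k k.zero_le
  have key : ∀ k m, k ≤ m → ∀ᶠ y in ℓ, y ∈ O k → f k y + c k = f m y + c m := by
    intro k m hkm
    obtain ⟨d, hd⟩ := hdiff k m hkm
    have hx := hm k.zero_le hx₀
    have hdc : d = c m - c k := by
      refine hℓ.const_unique (hd x₀ hx) ?_
      filter_upwards [hcc k x₀ hx₀, hcc m x₀ hx₀] with y h h'
      simp only [Pi.sub_apply] at *
      rw [← h, ← h']
      abel
    have := hℓ.of_forall (O k) (fun y => f k y + c k = f m y + c m) (ho k) fun x hx => by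
      filter_upwards [hd x hx] with y hy
      simp only [Pi.sub_apply, hdc, sub_eq_sub_iff_add_eq_add] at hy ⊢
      rw [hy]
      abel
    exact this
  refine ⟨fun y => if h : ∃ k, y ∈ O k then f (Nat.find h) y + c (Nat.find h) else 0,
    fun x hx => ?_⟩
  obtain ⟨m, hxm⟩ := mem_iUnion.1 hx
  refine ((hf m x hxm).add (.const (c m))).congr ?_
  -- On `O m` the first index containing `y` is at most `m`, so only finitely many comparisons,
  -- hence a finite intersection of members of `ℓ`, are needed.
  have hall : ∀ᶠ y in ℓ, ∀ k ∈ Finset.range (m + 1), y ∈ O k → f k y + c k = f m y + c m :=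
    (Finset.eventually_all _).2 fun k hk => key k m (Nat.lt_succ_iff.1 (Finset.mem_range.1 hk))
  filter_upwards [mem_inf_of_left ((ho m).mem_nhds hxm), mem_inf_of_right hall] with y hy hy'
  have h : ∃ k, y ∈ O k := ⟨m, hy⟩
  have := hy' _ (Finset.mem_range.2 (Nat.lt_succ_iff.2 (Nat.find_min' h hy))) (Nat.find_spec h)
  simp only [Pi.add_apply, Pi.sub_apply, dif_pos h, this]
  abel

/-- Compactness of `[c, d]` in the form of a supremum argument, for a property of open intervals
that passes to subintervals and to unions of overlapping intervals. The margin `δ` in the set `A`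
makes the next interval overlap the previous one. -/
theorem interval_induction {P : ℝ → ℝ → Prop}
    (mono : ∀ {s t s' t'}, s ≤ s' → t' ≤ t → P s t → P s' t')
    (glue : ∀ {s t u v}, s < t → t < u → u < v → P s u → P t v → P s v)
    {c d : ℝ} (hcd : c ≤ d) (loc : ∀ x, ∃ δ > 0, P (x - δ) (x + δ)) : P c d := by
  have glue' : ∀ {s t u v}, t < u → P s u → P t v → P s v := by
    intro s t u v htu h h'
    rcases le_or_gt t s with hs | hs
    · exact mono hs le_rfl h'
    rcases le_or_gt v u with hv | hv
    · exact mono le_rfl hv h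
    exact glue hs htu hv h h'
  let A : Set ℝ := {t | t ∈ Icc c d ∧ ∃ δ > 0, P (c - δ) (t + δ)}
  have hcA : c ∈ A := ⟨left_mem_Icc.2 hcd, loc c⟩
  have hbdd : BddAbove A := ⟨d, fun t ht => ht.1.2⟩
  have hT : sSup A ≤ d := csSup_le ⟨c, hcA⟩ fun t ht => ht.1.2
  have hT' : c ≤ sSup A := le_csSup hbdd hcA
  obtain ⟨δ, hδ, hP⟩ := loc (sSup A)
  obtain ⟨t, ⟨_, η, hη, hPt⟩, ht⟩ := exists_lt_of_lt_csSup ⟨c, hcA⟩ (sub_lt_self (sSup A) hδ)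
  have h := glue' (by linarith) hPt hP
  by_cases hTd : sSup A < d
  · exfalso
    have : min (sSup A + δ / 2) d ∈ A := by
      refine ⟨⟨le_min (by linarith) hcd, min_le_right _ _⟩, min η (δ / 2), by positivity, ?_⟩
      refine mono ?_ ?_ h
      · linarith [min_le_left η (δ / 2)]
      · linarith [min_le_right η (δ / 2), min_le_left (sSup A + δ / 2) d]
    have := le_csSup hbdd this
    rcases min_le_iff.1 this with h | h <;> linarith
  · exact mono (by linarith) (by linarith) h

/-- On a coordinate plane coherent local potentials come from a function. -/
theorem hasPotential_range (hℓ : IsLocalFilter ℓ) {a : X → X → G} {e : ℝ × ℝ → X}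
    (he : IsOpenEmbedding e) (ha : ∀ q, Coherent ℓ a (e q)) : HasPotential ℓ a (range e) := by
  have hopen : ∀ s t u v : ℝ, IsOpen (e '' (Ioo s t ×ˢ Ioo u v)) := fun s t u v =>
    he.isOpenMap _ (isOpen_Ioo.prod isOpen_Ioo)
  have hconn : ∀ s t u v : ℝ, IsPreconnected (e '' (Ioo s t ×ˢ Ioo u v)) := fun s t u v =>
    (isPreconnected_Ioo.prod isPreconnected_Ioo).image _ he.continuous.continuousOn
  have hinter : ∀ s t u v s' t' u' v' : ℝ, IsPreconnected
      (e '' (Ioo s t ×ˢ Ioo u v) ∩ e '' (Ioo s' t' ×ˢ Ioo u' v')) := by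
    intro s t u v s' t' u' v'
    rw [← image_inter he.injective, prod_inter_prod, Ioo_inter_Ioo, Ioo_inter_Ioo]
    exact hconn _ _ _ _
  -- Gluing vertically gives a potential on a thin strip around each abscissa; the width shrinks
  -- finitely often and stays positive.
  have hstrip : ∀ c d, c ≤ d → ∀ x : ℝ, ∃ δ > 0,
      HasPotential ℓ a (e '' (Ioo (x - δ) (x + δ) ×ˢ Ioo c d)) := by
    intro c d hcd x
    refine interval_induction (P := fun s t => ∃ δ > 0,
      HasPotential ℓ a (e '' (Ioo (x - δ) (x + δ) ×ˢ Ioo s t))) ?_ ?_ hcd ?_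
    · rintro s t s' t' hs ht ⟨δ, hδ, h⟩
      exact ⟨δ, hδ, h.mono (image_mono (prod_mono le_rfl (Ioo_subset_Ioo hs ht)))⟩
    · rintro s t u v hst htu huv ⟨δ, hδ, h⟩ ⟨δ', hδ', h'⟩
      refine ⟨min δ δ', lt_min hδ hδ', ?_⟩
      have key := HasPotential.glue hℓ (hopen (x - min δ δ') (x + min δ δ') s u)
        (hopen (x - min δ δ') (x + min δ δ') t v) (hinter _ _ _ _ _ _ _ _)
        (h.mono (image_mono (prod_mono (Ioo_subset_Ioo
          (sub_le_sub_left (min_le_left _ _) _) (by gcongr; exact min_le_left _ _)) le_rfl)))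
        (h'.mono (image_mono (prod_mono (Ioo_subset_Ioo
          (sub_le_sub_left (min_le_right _ _) _) (by gcongr; exact min_le_right _ _)) le_rfl)))
      rwa [← image_union, ← prod_union, Ioo_union_Ioo' htu (hst.trans (htu.trans huv)),
        min_eq_left hst.le, max_eq_right huv.le] at key
    · intro y
      obtain ⟨U, hU, h⟩ := (ha (x, y)).hasPotential
      have := he.continuous.continuousAt.preimage_mem_nhds hU
      obtain ⟨δ, hδ, hb⟩ := Metric.mem_nhds_iff.1 this
      refine ⟨δ, hδ, δ, hδ, h.mono ?_⟩
      rw [image_subset_iff]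
      refine Subset.trans ?_ hb
      rw [← ball_prod_same, Real.ball_eq_Ioo, Real.ball_eq_Ioo]
  -- Gluing the strips horizontally gives squares, which then exhaust the plane. All overlaps are
  -- rectangles, hence preconnected.
  have hsq : ∀ c d, c ≤ d → HasPotential ℓ a (e '' (Ioo c d ×ˢ Ioo c d)) := by
    intro c d hcd
    refine interval_induction (P := fun s t => HasPotential ℓ a (e '' (Ioo s t ×ˢ Ioo c d)))
      ?_ ?_ hcd (hstrip c d hcd)
    · intro s t s' t' hs ht h
      exact h.mono (image_mono (prod_mono (Ioo_subset_Ioo hs ht) le_rfl))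
    · intro s t u v hst htu huv h h'
      have key := HasPotential.glue hℓ (hopen s u c d) (hopen t v c d)
        (hinter _ _ _ _ _ _ _ _) h h'
      rwa [← image_union, ← union_prod, Ioo_union_Ioo' htu (hst.trans (htu.trans huv)),
        min_eq_left hst.le, max_eq_right huv.le] at key
  have key := HasPotential.iUnion hℓ
    (O := fun k : ℕ => e '' (Ioo (-(k + 1 : ℝ)) (k + 1) ×ˢ Ioo (-(k + 1 : ℝ)) (k + 1)))
    (fun k => hopen _ _ _ _) (fun k => hconn _ _ _ _)
    (fun k m hkm => image_mono (prod_mono (Ioo_subset_Ioo (by gcongr) (by gcongr))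
      (Ioo_subset_Ioo (by gcongr) (by gcongr))))
    (x₀ := e 0) (mem_image_of_mem _ (by simp))
    (fun k => hsq _ _ (by linarith [k.cast_nonneg (α := ℝ)]))
  refine key.mono ?_
  rintro _ ⟨q, rfl⟩
  obtain ⟨k, hk⟩ := exists_nat_gt (max |q.1| |q.2|)
  have h₁ := abs_lt.1 ((le_max_left |q.1| |q.2|).trans_lt hk)
  have h₂ := abs_lt.1 ((le_max_right |q.1| |q.2|).trans_lt hk)
  exact mem_iUnion.2 ⟨k, mem_image_of_mem _
    ⟨⟨by linarith, by linarith⟩, ⟨by linarith, by linarith⟩⟩⟩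

end Potentials

/-! ### Coordinate planes and ramification -/

section Planes

theorem isPreconnected_norm_gt (r : ℝ) (hr : 0 ≤ r) : IsPreconnected {q : ℝ × ℝ | r < ‖q‖} := by
  have hrank : 1 < Module.rank ℝ (ℝ × ℝ) := by
    rw [rank_prod', Module.rank_self, one_add_one_eq_two]; exact Cardinal.one_lt_two
  have h := (isConnected_compl_singleton_of_one_lt_rank hrank 0).isPreconnected
  -- This map moves points radially outwards and increases the norm by exactly `r`, so the outer
  -- region is an image of the punctured plane.
  have hcont : ContinuousOn (fun q : ℝ × ℝ => (1 + r * ‖q‖⁻¹) • q) {0}ᶜ := by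
    intro q hq
    have : ‖q‖ ≠ 0 := by simpa using hq
    exact ((continuousAt_const.add (continuousAt_const.mul
      (continuousAt_id.norm.inv₀ this))).smul continuousAt_id).continuousWithinAt
  convert h.image _ hcont using 1
  ext w
  constructor
  · intro hw
    have hw' : r < ‖w‖ := hw
    have h0 : ‖w‖ ≠ 0 := by linarith
    refine ⟨(1 - r * ‖w‖⁻¹) • w, ?_, ?_⟩
    · simp only [mem_compl_iff, mem_singleton_iff, smul_eq_zero, not_or]
      refine ⟨fun h => ?_, by simpa using h0⟩
      field_simp at h
      linarith
    · have hpos : 0 < 1 - r * ‖w‖⁻¹ := by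
        rw [sub_pos, mul_inv_lt_iff₀ (by positivity)]; linarith
      simp only [norm_smul, Real.norm_of_nonneg hpos.le, smul_smul]
      convert one_smul ℝ w using 2
      have : ‖w‖ - r ≠ 0 := by linarith
      field_simp
      ring
  · rintro ⟨q, hq, rfl⟩
    have hq' : 0 < ‖q‖ := norm_pos_iff.2 (by simpa using hq)
    simp only [mem_ofPred_eq, norm_smul]
    rw [Real.norm_of_nonneg (by positivity)]
    field_simp
    linarith

theorem isPreconnected_compl_zero : IsPreconnected ({0}ᶜ : Set (ℝ × ℝ)) := by
  convert isPreconnected_norm_gt 0 le_rfl using 1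
  ext q
  simp

variable {X : Type*} [TopologicalSpace X]

theorem exists_plane [ChartedSpace (EuclideanSpace ℝ (Fin 2)) X] {x : X} {U : Set X}
    (hU : U ∈ 𝓝 x) : ∃ e : ℝ × ℝ → X, IsOpenEmbedding e ∧ e 0 = x ∧ range e ⊆ U := by
  let φ := chartAt (EuclideanSpace ℝ (Fin 2)) x
  have hx : x ∈ φ.source := mem_chart_source _ x
  have hV : φ.target ∩ φ.symm ⁻¹' U ∈ 𝓝 (φ x) := by
    refine inter_mem (φ.open_target.mem_nhds (φ.map_source hx)) ?_
    refine (φ.continuousAt_symm (φ.map_source hx)).preimage_mem_nhds ?_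
    rwa [φ.left_inv hx]
  obtain ⟨r, hr, hb⟩ := Metric.mem_nhds_iff.1 hV
  -- `univBall` identifies the whole Euclidean plane with a small ball in the chart.
  let ψ := (OpenPartialHomeomorph.univBall (φ x) r).trans φ.symm
  have hψ : ψ.source = univ := by
    refine eq_univ_of_forall fun y => ?_
    simp only [ψ, OpenPartialHomeomorph.trans_source, OpenPartialHomeomorph.univBall_source,
      univ_inter, OpenPartialHomeomorph.symm_source, mem_preimage]
    refine (hb ?_).1
    rw [← OpenPartialHomeomorph.univBall_target _ hr]
    exact OpenPartialHomeomorph.map_source _ (by simp)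
  let k : (ℝ × ℝ) ≃L[ℝ] EuclideanSpace ℝ (Fin 2) :=
    (ContinuousLinearEquiv.finTwoArrow ℝ ℝ).symm.trans (EuclideanSpace.equiv (Fin 2) ℝ).symm
  refine ⟨ψ ∘ k, (ψ.isOpenEmbedding hψ).comp k.toHomeomorph.isOpenEmbedding, ?_, ?_⟩
  · simp [ψ, φ.left_inv hx]
  · rintro _ ⟨q, rfl⟩
    refine (hb ?_ : _ ∈ φ.target ∩ φ.symm ⁻¹' U).2
    rw [← OpenPartialHomeomorph.univBall_target _ hr]
    exact OpenPartialHomeomorph.map_source _ (by simp)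

variable {e : ℝ × ℝ → X}

theorem compl_mem_denseInterior_of_isNowhereDense {N : Set X} (h : IsNowhereDense N) :
    Nᶜ ∈ denseInterior X := by
  rw [mem_denseInterior, interior_compl]
  exact interior_eq_empty_iff_dense_compl.1 h

theorem isNowhereDense_plane_line (f : ℝ × ℝ → ℝ) (hf : Continuous f)
    (h : ∀ q U, f q = 0 → U ∈ 𝓝 q → ∃ q' ∈ U, f q' ≠ 0) : IsNowhereDense {q | f q = 0} := by
  rw [IsNowhereDense, (isClosed_eq hf continuous_const).closure_eq]
  refine eq_empty_of_forall_notMem fun q hq => ?_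
  obtain ⟨q', hq', hne⟩ := h q _ (interior_subset hq : q ∈ {q | f q = 0})
    (mem_interior_iff_mem_nhds.1 hq)
  exact hne hq'

theorem isNowhereDense_axis : IsNowhereDense {q : ℝ × ℝ | q.2 = 0} := by
  refine isNowhereDense_plane_line _ continuous_snd fun q U hq hU => ?_
  have h : Tendsto (fun t : ℝ => ((q.1, t) : ℝ × ℝ)) (𝓝[≠] 0) (𝓝 q) := by
    have : Continuous fun t : ℝ => ((q.1, t) : ℝ × ℝ) := by fun_prop
    have h := this.tendsto 0
    rw [← (hq : q.2 = 0)] at h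
    exact h.mono_left nhdsWithin_le_nhds |>.mono_left (by rw [hq])
  obtain ⟨t, ht, ht'⟩ := ((h.eventually hU).and self_mem_nhdsWithin).exists
  exact ⟨_, ht, ht'⟩

theorem axis_compl_mem (he : IsOpenEmbedding e) :
    (e '' {q | q.2 = 0})ᶜ ∈ denseInterior X :=
  compl_mem_denseInterior_of_isNowhereDense (he.isInducing.isNowhereDense_image isNowhereDense_axis)

theorem compl_singleton_mem_denseInterior (he : IsOpenEmbedding e) (q : ℝ × ℝ) :
    ({e q}ᶜ : Set X) ∈ denseInterior X := by
  have := compl_mem_denseInterior_of_isNowhereDense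
    (he.isInducing.isNowhereDense_image (isNowhereDense_plane_line
      (fun q' => ‖q' - q‖) (by fun_prop)
      fun q' U hq hU => by
        obtain rfl : q' = q := by simpa [sub_eq_zero] using hq
        have : (𝓝[≠] q').NeBot := inferInstance
        obtain ⟨p, hp, hp'⟩ := (Filter.Eventually.and
          (nhdsWithin_le_nhds hU : ∀ᶠ p in 𝓝[≠] q', p ∈ U) self_mem_nhdsWithin).exists
        exact ⟨p, hp, by simpa [sub_eq_zero] using hp'⟩))
  refine mem_of_superset this fun x hx hxq => hx ⟨q, by simp, Eq.symm hxq⟩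

/-- The four open half planes. -/
theorem isOpenEmbedding_halfPlanes :
    (IsOpenEmbedding fun q : ℝ × ℝ => (Real.exp q.1, q.2)) ∧
    (IsOpenEmbedding fun q : ℝ × ℝ => (-Real.exp q.1, q.2)) ∧
    (IsOpenEmbedding fun q : ℝ × ℝ => (q.1, Real.exp q.2)) ∧
    (IsOpenEmbedding fun q : ℝ × ℝ => (q.1, -Real.exp q.2)) := by
  have h := Real.isOpenEmbedding_exp
  have h' := (Homeomorph.neg ℝ).isOpenEmbedding.comp h
  exact ⟨h.prodMap .id, h'.prodMap .id, IsOpenEmbedding.prodMap .id h,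
    IsOpenEmbedding.prodMap .id h'⟩

/-- The punctured plane is the union of four open half planes, each a coordinate plane through
`Real.exp`. The right, top and left ones glue to one potential `f`. It meets the bottom half plane,
with potential `g`, in two quadrants, where `f - g` has the values `c` and `d`; the difference `c -
d` is the monodromy around the puncture. -/
theorem exists_potentials_around_puncture {G : Type*} [AddCommGroup G] {ℓ : Filter X}
    (hℓ : IsLocalFilter ℓ) (he : IsOpenEmbedding e)
    {a : X → X → G} (ha : ∀ q ≠ 0, Coherent ℓ a (e q)) :
    ∃ (f g : X → G) (c d : G),
      (∀ q : ℝ × ℝ, 0 < q.1 ∨ 0 < q.2 ∨ q.1 < 0 → EvConst ℓ (e q) (f - a (e q))) ∧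
      (∀ q : ℝ × ℝ, q.2 < 0 → EvConst ℓ (e q) (g - a (e q))) ∧
      (∀ q : ℝ × ℝ, 0 < q.1 → q.2 < 0 → ∀ᶠ y in 𝓝 (e q) ⊓ ℓ, (f - g) y = c) ∧
      (∀ q : ℝ × ℝ, q.1 < 0 → q.2 < 0 → ∀ᶠ y in 𝓝 (e q) ⊓ ℓ, (f - g) y = d) := by
  obtain ⟨hR, hL, hT, hB⟩ := isOpenEmbedding_halfPlanes
  have pR : HasPotential ℓ a (e '' {q | 0 < q.1}) := by
    refine (hasPotential_range hℓ (he.comp hR) fun q => ha _ ?_).mono ?_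
    · simp [Prod.ext_iff, Real.exp_ne_zero]
    · rintro _ ⟨q, hq, rfl⟩
      exact ⟨(Real.log q.1, q.2), by simp [Real.exp_log hq]⟩
  have pL : HasPotential ℓ a (e '' {q | q.1 < 0}) := by
    refine (hasPotential_range hℓ (he.comp hL) fun q => ha _ ?_).mono ?_
    · simp [Prod.ext_iff, Real.exp_ne_zero]
    · rintro _ ⟨q, hq, rfl⟩
      exact ⟨(Real.log (-q.1), q.2), congrArg e (Prod.ext (by
        simp only [Real.exp_log (neg_pos.2 hq), neg_neg]) rfl)⟩
  have pT : HasPotential ℓ a (e '' {q | 0 < q.2}) := by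
    refine (hasPotential_range hℓ (he.comp hT) fun q => ha _ ?_).mono ?_
    · simp [Prod.ext_iff, Real.exp_ne_zero]
    · rintro _ ⟨q, hq, rfl⟩
      exact ⟨(q.1, Real.log q.2), by simp [Real.exp_log hq]⟩
  have pB : HasPotential ℓ a (e '' {q | q.2 < 0}) := by
    refine (hasPotential_range hℓ (he.comp hB) fun q => ha _ ?_).mono ?_
    · simp [Prod.ext_iff, Real.exp_ne_zero]
    · rintro _ ⟨q, hq, rfl⟩
      exact ⟨(q.1, Real.log (-q.2)), congrArg e (Prod.ext rfl (by
        simp only [Real.exp_log (neg_pos.2 hq), neg_neg]))⟩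
  have oR : IsOpen {q : ℝ × ℝ | 0 < q.1} := isOpen_lt continuous_const continuous_fst
  have oL : IsOpen {q : ℝ × ℝ | q.1 < 0} := isOpen_lt continuous_fst continuous_const
  have oT : IsOpen {q : ℝ × ℝ | 0 < q.2} := isOpen_lt continuous_const continuous_snd
  have pRT := pR.glue hℓ (he.isOpenMap _ oR) (he.isOpenMap _ oT) (by
    rw [← image_inter he.injective]
    refine IsPreconnected.image ?_ e he.continuous.continuousOn
    convert (isPreconnected_Ioi (a := (0 : ℝ))).prod (isPreconnected_Ioi (a := (0 : ℝ))) using 1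
    ext q
    simp) pT
  rw [← image_union] at pRT
  -- The right and left half planes are disjoint, so the overlap is the upper left quadrant alone.
  have pRTL := pRT.glue hℓ (he.isOpenMap _ (oR.union oT)) (he.isOpenMap _ oL) (by
    rw [← image_inter he.injective]
    refine IsPreconnected.image ?_ e he.continuous.continuousOn
    convert (isPreconnected_Iio (a := (0 : ℝ))).prod (isPreconnected_Ioi (a := (0 : ℝ))) using 1
    ext q
    simp only [mem_inter_iff, mem_union, mem_ofPred_eq, mem_prod, mem_Iio, mem_Ioi]
    constructor
    · rintro ⟨h | h, h'⟩
      · exact (lt_asymm h h').elim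
      · exact ⟨h', h⟩
    · exact fun h => ⟨.inr h.2, h.1⟩) pL
  rw [← image_union] at pRTL
  obtain ⟨f, hf⟩ := pRTL
  obtain ⟨g, hg⟩ := pB
  have hf' : ∀ q : ℝ × ℝ, 0 < q.1 ∨ 0 < q.2 ∨ q.1 < 0 → EvConst ℓ (e q) (f - a (e q)) :=
    fun q hq => hf _ (mem_image_of_mem _ (by simpa [or_assoc] using hq))
  have hg' : ∀ q : ℝ × ℝ, q.2 < 0 → EvConst ℓ (e q) (g - a (e q)) :=
    fun q hq => hg _ (mem_image_of_mem _ hq)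
  obtain ⟨c, hc⟩ := hℓ.exists_const (h := f - g) (((isPreconnected_Ioi (a := (0 : ℝ))).prod
    (isPreconnected_Iio (a := (0 : ℝ)))).image e he.continuous.continuousOn) (by
      rintro _ ⟨q, hq, rfl⟩
      exact (hf' q (.inl hq.1)).trans (hg' q hq.2).sub_comm)
  obtain ⟨d, hd⟩ := hℓ.exists_const (h := f - g) (((isPreconnected_Iio (a := (0 : ℝ))).prod
    (isPreconnected_Iio (a := (0 : ℝ)))).image e he.continuous.continuousOn) (by
      rintro _ ⟨q, hq, rfl⟩
      exact (hf' q (.inr (.inr hq.1))).trans (hg' q hq.2).sub_comm)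
  exact ⟨f, g, c, d, hf', hg', fun q h₁ h₂ => hc _ (mem_image_of_mem _ ⟨h₁, h₂⟩),
    fun q h₁ h₂ => hd _ (mem_image_of_mem _ ⟨h₁, h₂⟩)⟩

/-- Near `p`, but away from `p` itself, the local potentials `a` come from a function. -/
def Unramified (a : X → X → ZMod 2) (p : X) : Prop :=
  ∃ f, ∀ᶠ x in 𝓝[≠] p, EvConst (denseInterior X) x (f - a x)

theorem Coherent.unramified {a : X → X → ZMod 2} {p : X} (h : Coherent (denseInterior X) a p) :
    Unramified a p :=
  ⟨a p, nhdsWithin_le_nhds h⟩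

theorem Unramified.add {a b : X → X → ZMod 2} {p : X} (ha : Unramified a p)
    (hb : Unramified b p) : Unramified (a + b) p := by
  obtain ⟨f, hf⟩ := ha
  obtain ⟨g, hg⟩ := hb
  refine ⟨f + g, ?_⟩
  filter_upwards [hf, hg] with x h h'
  simpa [add_sub_add_comm] using h.add h'

theorem add_self_zmod_two {Y Z : Type*} (a : Y → Z → ZMod 2) : a + a = 0 := by
  funext x y
  exact CharTwo.add_self_eq_zero _

open Classical in
/-- The ramification at `p`, mod 2. -/
noncomputable def ram (a : X → X → ZMod 2) (p : X) : ZMod 2 := if Unramified a p then 0 else 1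

theorem ram_eq_zero {a : X → X → ZMod 2} {p : X} : ram a p = 0 ↔ Unramified a p := by
  simp [ram]

theorem Set.Finite.eventually_punctured_notMem [T1Space X] {S : Set X} (hS : S.Finite) (p : X) :
    ∀ᶠ x in 𝓝[≠] p, x ∉ S := by
  rw [eventually_nhdsWithin_iff]
  filter_upwards [(hS.subset (sdiff_subset (t := {p}))).isClosed.isOpen_compl.mem_nhds
    (by simp : p ∈ (S \ {p})ᶜ)] with x hx hxp hxS
  exact hx ⟨hxS, hxp⟩

/-- Up to finitely many points, the local potentials `a` come from a function. -/
def nullClasses (X : Type*) [TopologicalSpace X] : Submodule (ZMod 2) (X → X → ZMod 2) where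
  carrier := {a | ∃ S : Set X, S.Finite ∧ HasPotential (denseInterior X) a Sᶜ}
  zero_mem' := ⟨∅, finite_empty, 0, fun x _ => by simpa using EvConst.zero⟩
  add_mem' := by
    rintro a b ⟨S, hS, f, hf⟩ ⟨T, hT, g, hg⟩
    refine ⟨S ∪ T, hS.union hT, f + g, fun x hx => ?_⟩
    simp only [compl_union] at hx
    simpa [add_sub_add_comm] using (hf x hx.1).add (hg x hx.2)
  smul_mem' := by
    rintro c a ⟨S, hS, f, hf⟩
    refine ⟨S, hS, c • f, fun x hx => ?_⟩
    obtain ⟨d, hd⟩ := hf x hx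
    refine ⟨c • d, ?_⟩
    filter_upwards [hd] with y hy
    rw [← hy]
    simp [mul_sub]

/-- An unramified class supported in a coordinate plane is trivial. -/
theorem mem_nullClasses_of_support [T2Space X] (he : IsOpenEmbedding e) {K S : Set X}
    (hK : IsCompact K) (hKe : K ⊆ range e) (hS : S.Finite) {a : X → X → ZMod 2}
    (ha : ∀ x ∉ S, Coherent (denseInterior X) a x) (hr : ∀ x, Unramified a x)
    (h0 : ∀ x ∉ K, a x = 0) : a ∈ nullClasses X := by
  classical
  have hL := isLocalFilter_denseInterior (X := X)
  choose f hf using hr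
  -- At the finitely many bad points the potential is replaced by the one that unramifiedness
  -- provides, which makes the family coherent everywhere. Bad points off `K` need no change, so the
  -- support stays in `K`.
  let b : X → X → ZMod 2 := fun x => if x ∈ S ∩ K then f x else a x
  have hb0 : ∀ x ∉ K, b x = 0 := fun x hx => by
    simp only [b, mem_inter_iff, hx, and_false, if_false, h0 x hx]
  have hba : ∀ x ∉ S, b x = a x := fun x hx => by simp [b, hx]
  have hb : ∀ x, Coherent (denseInterior X) b x := by
    intro x
    by_cases hxS : x ∈ S
    · by_cases hxK : x ∈ K
      · have hbx : b x = f x := by simp [b, hxS, hxK]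
        have := (hf x).and (hS.eventually_punctured_notMem x)
        filter_upwards [eventually_nhdsWithin_iff.1 this] with y hy
        by_cases hyx : y = x
        · rw [hyx, sub_self]
          exact .zero
        · rw [hbx, hba y (hy hyx).2]
          exact (hy hyx).1
      · filter_upwards [hK.isClosed.isOpen_compl.mem_nhds hxK] with y hy
        rw [hb0 x hxK, hb0 y hy, sub_self]
        exact .zero
    · filter_upwards [ha x hxS, hS.isClosed.isOpen_compl.mem_nhds hxS] with y hy hyS
      rwa [hba x hxS, hba y hyS]
  obtain ⟨F, hF⟩ := hasPotential_range hL he fun q => hb (e q)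
  obtain ⟨r, hr⟩ := ((he.isEmbedding.isCompact_preimage_iff hKe).2 hK).isBounded.subset_closedBall 0
  let r' := max r 0
  have hsub : K ⊆ e '' Metric.closedBall 0 r' := by
    intro x hx
    obtain ⟨q, rfl⟩ := hKe hx
    exact mem_image_of_mem _ (Metric.closedBall_subset_closedBall (le_max_left _ _) (hr hx))
  have hcl : IsClosed (e '' Metric.closedBall 0 r') :=
    ((isCompact_closedBall _ _).image he.continuous).isClosed
  have hinter : range e ∩ (e '' Metric.closedBall 0 r')ᶜ = e '' {q | r' < ‖q‖} := by
    ext x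
    constructor
    · rintro ⟨⟨q, rfl⟩, hq⟩
      refine ⟨q, ?_, rfl⟩
      by_contra h
      exact hq ⟨q, by simpa using h, rfl⟩
    · rintro ⟨q, hq, rfl⟩
      refine ⟨⟨q, rfl⟩, ?_⟩
      rintro ⟨q', hq', h⟩
      rw [he.injective h] at hq'
      have h₁ : ‖q‖ ≤ r' := by simpa using hq'
      exact absurd h₁ (not_le.2 hq)
  have hcomp : ∀ x ∈ (e '' Metric.closedBall 0 r')ᶜ, b x = 0 := fun x hx =>
    hb0 x fun h => hx (hsub h)
  -- The potential on the plane is glued to zero on the complement of a large disc. The overlap is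
  -- the outer region of the plane, which is preconnected, so a single constant suffices.
  obtain ⟨F', hF'⟩ := HasPotential.glue hL he.isOpen_range hcl.isOpen_compl
    (by
      rw [hinter]
      exact (isPreconnected_norm_gt r' (le_max_right _ _)).image e he.continuous.continuousOn)
    ⟨F, hF⟩ ⟨0, fun x hx => by rw [hcomp x hx, sub_zero]; exact .zero⟩
  refine ⟨S, hS, F', fun x hx => ?_⟩
  rw [← hba x hx]
  refine hF' x ?_
  by_cases h : x ∈ range e
  · exact .inl h
  · exact .inr fun h' => h (image_subset_range _ _ h')

/-! ### Removable points and additivity of the ramification -/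

variable [ChartedSpace (EuclideanSpace ℝ (Fin 2)) X]

/-- An isolated point is a removable singularity of an almost everywhere locally constant
function. -/
theorem EvConst.of_punctured {G : Type*} [AddCommGroup G] {p : X} {h : X → G}
    (hh : ∀ᶠ x in 𝓝[≠] p, EvConst (denseInterior X) x h) : EvConst (denseInterior X) p h := by
  obtain ⟨e, he, rfl, hU⟩ := exists_plane (eventually_nhdsWithin_iff.1 hh)
  have hL := isLocalFilter_denseInterior (X := X)
  have hO : IsOpen (e '' {0}ᶜ) := he.isOpenMap _ isOpen_compl_singleton
  obtain ⟨c, hc⟩ := hL.exists_const (isPreconnected_compl_zero.image e he.continuous.continuousOn)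
    (h := h) (by
      rintro _ ⟨q, hq, rfl⟩
      exact hU ⟨q, rfl⟩ fun h => hq (he.injective h))
  refine ⟨c, ?_⟩
  filter_upwards [mem_inf_of_right (hL.of_forall _ _ hO hc),
    mem_inf_of_right (compl_singleton_mem_denseInterior he 0),
    mem_inf_of_left (he.isOpen_range.mem_nhds ⟨0, rfl⟩)] with y h₁ h₂ h₃
  obtain ⟨q, rfl⟩ := h₃
  exact h₁ ⟨q, fun h => h₂ (by rw [h]; rfl), rfl⟩

/-- The monodromy around `p` is additive and takes values in `ZMod 2`, where two nonzero elements
have sum zero. -/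
theorem unramified_add_of_not {a b : X → X → ZMod 2} {p : X}
    (ha : ∀ᶠ x in 𝓝[≠] p, Coherent (denseInterior X) a x)
    (hb : ∀ᶠ x in 𝓝[≠] p, Coherent (denseInterior X) b x)
    (ha' : ¬ Unramified a p) (hb' : ¬ Unramified b p) : Unramified (a + b) p := by
  have hL := isLocalFilter_denseInterior (X := X)
  obtain ⟨e, he, rfl, hU⟩ := exists_plane (eventually_nhdsWithin_iff.1 (ha.and hb))
  have hne : ∀ q ≠ 0, e q ≠ e 0 := fun q hq h => hq (he.injective h)
  have oRTL : IsOpen {q : ℝ × ℝ | 0 < q.1 ∨ 0 < q.2 ∨ q.1 < 0} :=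
    (isOpen_lt continuous_const continuous_fst).union
      ((isOpen_lt continuous_const continuous_snd).union
        (isOpen_lt continuous_fst continuous_const))
  have oB : IsOpen {q : ℝ × ℝ | q.2 < 0} := isOpen_lt continuous_snd continuous_const
  -- If the two constants coincide, the monodromy vanishes and the two potentials glue around the
  -- whole puncture.
  have key : ∀ (k : X → X → ZMod 2) (f g : X → ZMod 2) (c : ZMod 2),
      (∀ q : ℝ × ℝ, 0 < q.1 ∨ 0 < q.2 ∨ q.1 < 0 →
        EvConst (denseInterior X) (e q) (f - k (e q))) →
      (∀ q : ℝ × ℝ, q.2 < 0 → EvConst (denseInterior X) (e q) (g - k (e q))) →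
      (∀ q : ℝ × ℝ, 0 < q.1 → q.2 < 0 →
        ∀ᶠ y in 𝓝 (e q) ⊓ denseInterior X, (f - g) y = c) →
      (∀ q : ℝ × ℝ, q.1 < 0 → q.2 < 0 →
        ∀ᶠ y in 𝓝 (e q) ⊓ denseInterior X, (f - g) y = c) → Unramified k (e 0) := by
    intro k f g c hf hg hc hd
    obtain ⟨F, hF⟩ := HasPotential.glue_of_const hL (he.isOpenMap _ oRTL) (he.isOpenMap _ oB)
      (a := k) (f₁ := f) (f₂ := g) (c := c)
      (by rintro _ ⟨q, hq, rfl⟩; exact hf q hq) (by rintro _ ⟨q, hq, rfl⟩; exact hg q hq)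
      (by
        rw [← image_inter he.injective]
        rintro _ ⟨q, ⟨h₁, h₂⟩, rfl⟩
        rcases h₁ with h | h | h
        · exact hc q h h₂
        · exact (lt_asymm h h₂).elim
        · exact hd q h h₂)
    refine ⟨F, eventually_nhdsWithin_iff.2 ?_⟩
    filter_upwards [he.isOpen_range.mem_nhds ⟨0, rfl⟩] with x hx hx'
    obtain ⟨q, rfl⟩ := hx
    refine hF _ ?_
    rw [← image_union]
    refine mem_image_of_mem _ ?_
    have hq : q ≠ 0 := fun h => hx' (by rw [h]; rfl)
    by_contra hcon
    simp only [mem_union, mem_ofPred_eq, not_or, not_lt] at hcon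
    exact hq (Prod.ext (le_antisymm hcon.1.1 hcon.1.2.2) (le_antisymm hcon.1.2.1 hcon.2))
  obtain ⟨f, g, c, d, hf, hg, hc, hd⟩ := exists_potentials_around_puncture hL he
    fun q hq => (hU ⟨q, rfl⟩ (hne q hq)).1
  obtain ⟨f', g', c', d', hf', hg', hc', hd'⟩ := exists_potentials_around_puncture hL he
    fun q hq => (hU ⟨q, rfl⟩ (hne q hq)).2
  have h₁ : c ≠ d := fun h => ha' (key a f g c hf hg hc (h ▸ hd))
  have h₂ : c' ≠ d' := fun h => hb' (key b f' g' c' hf' hg' hc' (h ▸ hd'))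
  have h₃ : c + c' = d + d' := by
    clear hc hd hc' hd'
    revert c d c' d'
    decide
  refine key (a + b) (f + f') (g + g') (c + c') ?_ ?_ ?_ ?_
  · intro q hq
    simpa [add_sub_add_comm] using (hf q hq).add (hf' q hq)
  · intro q hq
    simpa [add_sub_add_comm] using (hg q hq).add (hg' q hq)
  · intro q hq hq'
    filter_upwards [hc q hq hq', hc' q hq hq'] with y h h'
    rw [add_sub_add_comm, Pi.add_apply, h, h']
  · intro q hq hq'
    filter_upwards [hd q hq hq', hd' q hq hq'] with y h h'
    rw [add_sub_add_comm, Pi.add_apply, h, h', h₃]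

theorem ram_add {a b : X → X → ZMod 2} {p : X}
    (ha : ∀ᶠ x in 𝓝[≠] p, Coherent (denseInterior X) a x)
    (hb : ∀ᶠ x in 𝓝[≠] p, Coherent (denseInterior X) b x) :
    ram (a + b) p = ram a p + ram b p := by
  by_cases h : Unramified a p <;> by_cases h' : Unramified b p
  · simp [ram, h, h', h.add h']
  · have : ¬ Unramified (a + b) p := fun h'' => h' (by
      simpa [← add_assoc, add_self_zmod_two] using h.add h'')
    simp [ram, h, h', this]
  · have : ¬ Unramified (a + b) p := fun h'' => h (by
      simpa [add_assoc, add_self_zmod_two] using h''.add h')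
    simp [ram, h, h', this]
  · simp only [ram, h, h', unramified_add_of_not ha hb h h', if_true, if_false]
    decide

end Planes

/-! ### Edges -/

section Edges

set_option linter.unusedSectionVars false

variable {X : Type*} [TopologicalSpace X] {e : ℝ × ℝ → X}

theorem eventually_vertical {w : ℝ × ℝ} (hw : w.2 = 0) {p : ℝ × ℝ → Prop}
    (h : ∀ᶠ q in 𝓝 w, p q) : ∀ᶠ t : ℝ in 𝓝 0, p (w.1, t) := by
  have hc : Continuous fun t : ℝ => ((w.1, t) : ℝ × ℝ) := by fun_prop
  have hw' : w = (w.1, 0) := Prod.ext rfl hw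
  rw [hw'] at h
  exact hc.continuousAt.eventually h

theorem exists_pos_of_eventually {w : ℝ × ℝ} (hw : w.2 = 0) {p : ℝ × ℝ → Prop}
    (h : ∀ᶠ q in 𝓝 w, p q) : ∃ q : ℝ × ℝ, 0 < q.2 ∧ p q := by
  obtain ⟨t, ht, ht'⟩ := (((eventually_vertical hw h).filter_mono nhdsWithin_le_nhds).and
    (self_mem_nhdsWithin : ∀ᶠ t in 𝓝[>] (0 : ℝ), t ∈ Ioi 0)).exists
  exact ⟨_, ht', ht⟩

theorem exists_neg_of_eventually {w : ℝ × ℝ} (hw : w.2 = 0) {p : ℝ × ℝ → Prop}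
    (h : ∀ᶠ q in 𝓝 w, p q) : ∃ q : ℝ × ℝ, q.2 < 0 ∧ p q := by
  obtain ⟨t, ht, hneg⟩ := (((eventually_vertical hw h).filter_mono nhdsWithin_le_nhds).and
    (self_mem_nhdsWithin : ∀ᶠ t in 𝓝[<] (0 : ℝ), t ∈ Iio 0)).exists
  exact ⟨(w.1, t), hneg, ht⟩

/-- The indicator function of the upper side of the horizontal axis. -/
noncomputable def upperSide (e : ℝ × ℝ → X) : X → ZMod 2 :=
  (e '' {q | 0 < q.2}).indicator 1

theorem upperSide_of_pos {q : ℝ × ℝ} (hq : 0 < q.2) : upperSide e (e q) = 1 := by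
  have h : e q ∈ e '' {q | 0 < q.2} := ⟨q, hq, rfl⟩
  simp only [upperSide, indicator_of_mem h, Pi.one_apply]

theorem upperSide_of_nonpos (he : IsOpenEmbedding e) {q : ℝ × ℝ} (hq : q.2 ≤ 0) :
    upperSide e (e q) = 0 := by
  refine indicator_of_notMem ?_ _
  rintro ⟨q', hq', h⟩
  rw [he.injective h] at hq'
  exact absurd hq (not_le.2 hq')

theorem eventually_upperSide (he : IsOpenEmbedding e) {q : ℝ × ℝ} (hq : q.2 ≠ 0) :
    ∀ᶠ y in 𝓝 (e q), upperSide e y = upperSide e (e q) := by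
  rw [← he.map_nhds_eq, eventually_map]
  rcases lt_or_gt_of_ne hq with h | h
  · filter_upwards [(isOpen_lt continuous_snd continuous_const).mem_nhds h] with q' hq'
    rw [upperSide_of_nonpos he (le_of_lt hq'), upperSide_of_nonpos he h.le]
  · filter_upwards [(isOpen_lt continuous_const continuous_snd).mem_nhds h] with q' hq'
    rw [upperSide_of_pos hq', upperSide_of_pos h]

theorem evConst_upperSide (he : IsOpenEmbedding e) {q : ℝ × ℝ} (hq : q.2 ≠ 0) :
    EvConst (denseInterior X) (e q) (upperSide e) :=
  ⟨_, mem_inf_of_left (eventually_upperSide he hq)⟩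

/-- An almost everywhere locally constant function on both sides of the axis is, up to a constant,
a multiple of `upperSide`; the multiple is the difference between the values on the two sides. -/
theorem jump_eq (he : IsOpenEmbedding e) {w : ℝ × ℝ} (hw : w.2 = 0) {f : X → ZMod 2}
    {j c d : ZMod 2} (hj : EvConst (denseInterior X) (e w) (f - j • upperSide e))
    (hc : ∀ᶠ q in 𝓝 w, 0 < q.2 → ∀ᶠ y in 𝓝 (e q) ⊓ denseInterior X, f y = c)
    (hd : ∀ᶠ q in 𝓝 w, q.2 < 0 → ∀ᶠ y in 𝓝 (e q) ⊓ denseInterior X, f y = d) :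
    c - d = j := by
  have hL := isLocalFilter_denseInterior (X := X)
  obtain ⟨k, hk⟩ := hj
  have hk' := he.continuous.continuousAt.eventually (eventually_nhds_eventually_inf hk)
  obtain ⟨q, hq, h₁, h₂⟩ := exists_pos_of_eventually hw (hk'.and hc)
  obtain ⟨r, hr, h₃, h₄⟩ := exists_neg_of_eventually hw (hk'.and hd)
  have e₁ : c - j = k := by
    refine hL.const_unique (x := e q) (h := f - j • upperSide e) ?_ h₁
    filter_upwards [h₂ hq, mem_inf_of_left (eventually_upperSide he hq.ne')] with y hy hy'
    simp only [upperSide_of_pos hq] at hy'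
    simp [hy, hy']
  have e₂ : d = k := by
    refine hL.const_unique (x := e r) (h := f - j • upperSide e) ?_ h₃
    filter_upwards [h₄ hr, mem_inf_of_left (eventually_upperSide he hr.ne)] with y hy hy'
    simp only [upperSide_of_nonpos he hr.le] at hy'
    simp [hy, hy']
  rw [e₂, ← e₁]
  abel

open Classical in
/-- The local potentials that jump across the segment from `(α, 0)` to `(β, 0)`. -/
noncomputable def segmentPotential (e : ℝ × ℝ → X) (α β : ℝ) : X → X → ZMod 2 := fun x =>
  if x ∈ e '' {q | α < q.1 ∧ q.1 < β ∧ q.2 = 0} then upperSide e else 0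

theorem segmentPotential_of_mem {α β : ℝ} {q : ℝ × ℝ} (h : α < q.1 ∧ q.1 < β ∧ q.2 = 0) :
    segmentPotential e α β (e q) = upperSide e :=
  if_pos ⟨q, h, rfl⟩

theorem segmentPotential_of_notMem (he : IsOpenEmbedding e) {α β : ℝ} {q : ℝ × ℝ}
    (h : ¬ (α < q.1 ∧ q.1 < β ∧ q.2 = 0)) : segmentPotential e α β (e q) = 0 := by
  refine if_neg ?_
  rintro ⟨q', hq', h'⟩
  rw [he.injective h'] at hq'
  exact h hq'

theorem segmentPotential_support {α β : ℝ} {x : X} (hx : x ∉ e '' (Icc α β ×ˢ {0})) :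
    segmentPotential e α β x = 0 := by
  refine if_neg ?_
  rintro ⟨q, ⟨h₁, h₂, h₃⟩, rfl⟩
  exact hx ⟨q, ⟨⟨h₁.le, h₂.le⟩, h₃⟩, rfl⟩

theorem isCompact_segment_image (he : IsOpenEmbedding e) (α β : ℝ) :
    IsCompact (e '' (Icc α β ×ˢ {0})) :=
  (isCompact_Icc.prod isCompact_singleton).image he.continuous

/-- Near an interior point of the segment, all points of the axis carry the same potential
`upperSide e`, which is locally constant off the axis. Away from the compact segment the family
vanishes. -/
theorem coherent_segmentPotential [T2Space X] (he : IsOpenEmbedding e) {α β : ℝ} {x : X}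
    (hα : x ≠ e (α, 0)) (hβ : x ≠ e (β, 0)) :
    Coherent (denseInterior X) (segmentPotential e α β) x := by
  by_cases hx : x ∈ e '' (Icc α β ×ˢ {0})
  · obtain ⟨q, ⟨hq, hq0⟩, rfl⟩ := hx
    have hq0' : q.2 = 0 := hq0
    have hq' : α < q.1 ∧ q.1 < β := by
      constructor
      · refine lt_of_le_of_ne hq.1 fun h => hα (congrArg e (Prod.ext h.symm hq0))
      · refine lt_of_le_of_ne hq.2 fun h => hβ (congrArg e (Prod.ext h hq0))
    rw [Coherent, ← he.map_nhds_eq, eventually_map, segmentPotential_of_mem ⟨hq'.1, hq'.2, hq0'⟩]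
    filter_upwards [(isOpen_Ioo.preimage continuous_fst).mem_nhds hq'] with r hr
    by_cases hr0 : r.2 = 0
    · rw [segmentPotential_of_mem ⟨hr.1, hr.2, hr0⟩, sub_self]
      exact .zero
    · rw [segmentPotential_of_notMem he fun h => hr0 h.2.2, sub_zero]
      exact evConst_upperSide he hr0
  · filter_upwards [(isCompact_segment_image he α β).isClosed.isOpen_compl.mem_nhds hx] with y hy
    rw [segmentPotential_support hx, segmentPotential_support hy, sub_self]
    exact .zero

/-- A potential near the endpoint is constant on the upper and on the lower half of a small box, so
its jump across the axis is the same on both sides of the endpoint. But it would have to be 0 off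
the segment and 1 along it. -/
theorem not_unramified_segmentPotential_left (he : IsOpenEmbedding e) {α β : ℝ} (h : α < β) :
    ¬ Unramified (segmentPotential e α β) (e (α, 0)) := by
  rintro ⟨f, hf⟩
  have hL := isLocalFilter_denseInterior (X := X)
  have hf' := he.continuous.continuousAt.eventually (eventually_nhdsWithin_iff.1 hf)
  obtain ⟨δ, hδ, hb⟩ := Metric.eventually_nhds_iff_ball.1 hf'
  have hball : ∀ q : ℝ × ℝ, q ∈ Metric.ball ((α, 0) : ℝ × ℝ) δ ↔
      (α - δ < q.1 ∧ q.1 < α + δ) ∧ -δ < q.2 ∧ q.2 < δ := by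
    intro q
    rw [← ball_prod_same, mem_prod, Real.ball_eq_Ioo, Real.ball_eq_Ioo]
    simp
  have hb' : ∀ q : ℝ × ℝ, (α - δ < q.1 ∧ q.1 < α + δ) → (-δ < q.2 ∧ q.2 < δ) → q ≠ (α, 0) →
      EvConst (denseInterior X) (e q) (f - segmentPotential e α β (e q)) := fun q h₁ h₂ h₃ =>
    hb q ((hball q).2 ⟨h₁, h₂⟩) fun h => h₃ (he.injective h)
  have hconst : ∀ u v : ℝ, -δ ≤ u → v ≤ δ → (0 ≤ u ∨ v ≤ 0) →
      ∃ c, ∀ x ∈ e '' (Ioo (α - δ) (α + δ) ×ˢ Ioo u v),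
        ∀ᶠ y in 𝓝 x ⊓ denseInterior X, f y = c := by
    intro u v hu hv huv
    refine hL.exists_const ((isPreconnected_Ioo.prod isPreconnected_Ioo).image e
      he.continuous.continuousOn) ?_
    rintro _ ⟨q, ⟨h₁, h₂⟩, rfl⟩
    have hq : q.2 ≠ 0 := by
      rcases huv with h | h
      · exact (h.trans_lt h₂.1).ne'
      · exact (h₂.2.trans_le h).ne
    have := hb' q h₁ ⟨hu.trans_lt h₂.1, h₂.2.trans_le hv⟩ fun h => hq (by rw [h])
    rwa [segmentPotential_of_notMem he fun h => hq h.2.2, sub_zero] at this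
  obtain ⟨c, hc⟩ := hconst 0 δ (by linarith) le_rfl (.inl le_rfl)
  obtain ⟨d, hd⟩ := hconst (-δ) 0 le_rfl hδ.le (.inr le_rfl)
  have key : ∀ t j, α - δ < t → t < α + δ →
      EvConst (denseInterior X) (e (t, 0)) (f - j • upperSide e) → c - d = j := by
    intro t j h₁ h₂ hj
    have hnear : ∀ᶠ q : ℝ × ℝ in 𝓝 (t, 0), q ∈ Ioo (α - δ) (α + δ) ×ˢ Ioo (-δ) δ :=
      (isOpen_Ioo.prod isOpen_Ioo).mem_nhds ⟨⟨h₁, h₂⟩, by simpa using hδ⟩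
    refine jump_eq he rfl hj ?_ ?_
    · filter_upwards [hnear] with q hq hq'
      exact hc _ (mem_image_of_mem _ ⟨hq.1, hq', hq.2.2⟩)
    · filter_upwards [hnear] with q hq hq'
      exact hd _ (mem_image_of_mem _ ⟨hq.1, hq.2.1, hq'⟩)
  have h₀ := key (α - δ / 2) 0 (by linarith) (by linarith) (by
    have := hb' (α - δ / 2, 0) ⟨by simp; linarith, by simp; linarith⟩ (by simpa using hδ)
      (by simp [hδ.ne'])
    rw [segmentPotential_of_notMem he fun h => by simp at h; linarith] at this
    simpa using this)
  have hη : 0 < min δ (β - α) := lt_min hδ (by linarith)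
  have hη₁ := min_le_left δ (β - α)
  have hη₂ := min_le_right δ (β - α)
  -- The minimum keeps the test point both in the box and in the interior of the segment.
  have h₁ := key (α + min δ (β - α) / 2) 1 (by linarith) (by linarith) (by
    have := hb' (α + min δ (β - α) / 2, 0) ⟨by simp only; linarith, by simp only; linarith⟩
      (by simpa using hδ) (by simp [hη.ne'])
    rw [segmentPotential_of_mem ⟨by simp only; linarith, by simp only; linarith, rfl⟩] at this
    simpa using this)
  exact zero_ne_one (h₀.symm.trans h₁)

theorem segmentPotential_reflect (α β : ℝ) :
    segmentPotential (fun q : ℝ × ℝ => e (-q.1, q.2)) (-β) (-α) = segmentPotential e α β := by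
  have h : ∀ p : ℝ × ℝ → Prop, (fun q : ℝ × ℝ => e (-q.1, q.2)) '' {q | p q} =
      e '' {q | p (-q.1, q.2)} := by
    intro p
    ext x
    constructor
    · rintro ⟨q, hq, rfl⟩
      exact ⟨(-q.1, q.2), by simpa using hq, rfl⟩
    · rintro ⟨q, hq, rfl⟩
      exact ⟨(-q.1, q.2), hq, by simp⟩
  funext x
  have hset : {q : ℝ × ℝ | -β < -q.1 ∧ -q.1 < -α ∧ q.2 = 0} =
      {q : ℝ × ℝ | α < q.1 ∧ q.1 < β ∧ q.2 = 0} := by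
    ext q
    simp only [mem_ofPred_eq, neg_lt_neg_iff]
    tauto
  have hup : upperSide (fun q : ℝ × ℝ => e (-q.1, q.2)) = upperSide e := by
    simp only [upperSide, h]
  have hmem := (h fun q => -β < q.1 ∧ q.1 < -α ∧ q.2 = 0).trans (congrArg (e '' ·) hset)
  unfold segmentPotential
  rw [hup, hmem]

theorem isOpenEmbedding_reflect (he : IsOpenEmbedding e) :
    IsOpenEmbedding fun q : ℝ × ℝ => e (-q.1, q.2) :=
  he.comp ((Homeomorph.neg ℝ).isOpenEmbedding.prodMap .id)

theorem not_unramified_segmentPotential_right (he : IsOpenEmbedding e) {α β : ℝ} (h : α < β) :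
    ¬ Unramified (segmentPotential e α β) (e (β, 0)) := by
  have := not_unramified_segmentPotential_left (isOpenEmbedding_reflect he) (neg_lt_neg h)
  rwa [segmentPotential_reflect, neg_neg] at this

open Classical in
/-- The indicator function of a point. -/
noncomputable def pointMass (p x : X) : ZMod 2 := if x = p then 1 else 0

/-- The class `a` is dual to an arc from `p` to `q` inside `K`. -/
structure IsEdge (a : X → X → ZMod 2) (p q : X) (K : Set X) : Prop where
  coherent : ∀ x, x ≠ p → x ≠ q → Coherent (denseInterior X) a x
  ram_eq : ∀ x, ram a x = pointMass p x + pointMass q x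
  support : ∀ x ∉ K, a x = 0

theorem coherent_zero (x : X) : Coherent (denseInterior X) (0 : X → X → ZMod 2) x :=
  .of_forall fun y => by simpa using EvConst.zero

theorem isEdge_zero (p : X) (K : Set X) : IsEdge 0 p p K where
  coherent x _ _ := coherent_zero x
  ram_eq x := by
    rw [CharTwo.add_self_eq_zero, ram_eq_zero]
    exact (coherent_zero x).unramified
  support _ _ := rfl

theorem IsEdge.symm {a : X → X → ZMod 2} {p q : X} {K : Set X} (h : IsEdge a p q K) :
    IsEdge a q p K :=
  ⟨fun x hq hp => h.coherent x hp hq, fun x => (h.ram_eq x).trans (add_comm _ _), h.support⟩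

theorem isEdge_segmentPotential [T2Space X] (he : IsOpenEmbedding e) {α β : ℝ} (h : α < β) :
    IsEdge (segmentPotential e α β) (e (α, 0)) (e (β, 0)) (e '' (Icc α β ×ˢ {0})) where
  coherent x hα hβ := coherent_segmentPotential he hα hβ
  ram_eq x := by
    have hne : e (α, 0) ≠ e (β, 0) := fun h' => h.ne (congrArg Prod.fst (he.injective h'))
    by_cases hα : x = e (α, 0)
    · subst hα
      simp [ram, pointMass, not_unramified_segmentPotential_left he h, hne]
    by_cases hβ : x = e (β, 0)
    · subst hβ
      simp [ram, pointMass, not_unramified_segmentPotential_right he h, hα]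
    simp [ram, pointMass, hα, hβ, (coherent_segmentPotential he hα hβ).unramified]
  support x hx := segmentPotential_support hx

/-- The affine coordinate system with given images of `(0, 0)` and `(1, 0)`. -/
theorem exists_affine_homeomorph {u v : ℝ × ℝ} (huv : u ≠ v) :
    ∃ A : ℝ × ℝ ≃ₜ ℝ × ℝ, A (0, 0) = u ∧ A (1, 0) = v := by
  obtain ⟨u₁, u₂⟩ := u
  obtain ⟨v₁, v₂⟩ := v
  have hD : (v₁ - u₁) ^ 2 + (v₂ - u₂) ^ 2 ≠ 0 := by
    intro h
    refine huv (Prod.ext ?_ ?_)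
    · nlinarith [sq_nonneg (v₁ - u₁), sq_nonneg (v₂ - u₂)]
    · nlinarith [sq_nonneg (v₁ - u₁), sq_nonneg (v₂ - u₂)]
  -- In complex notation this is `q ↦ u + q (v - u)`; the inverse divides by `v - u`, which produces
  -- the denominator `|v - u|²`.
  refine ⟨{ toFun := fun q => (u₁ + (q.1 * (v₁ - u₁) - q.2 * (v₂ - u₂)),
              u₂ + (q.1 * (v₂ - u₂) + q.2 * (v₁ - u₁)))
            invFun := fun r => (((r.1 - u₁) * (v₁ - u₁) + (r.2 - u₂) * (v₂ - u₂)) /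
                ((v₁ - u₁) ^ 2 + (v₂ - u₂) ^ 2),
              ((r.2 - u₂) * (v₁ - u₁) - (r.1 - u₁) * (v₂ - u₂)) /
                ((v₁ - u₁) ^ 2 + (v₂ - u₂) ^ 2))
            left_inv := fun q => ?_
            right_inv := fun r => ?_
            continuous_toFun := by fun_prop
            continuous_invFun := by fun_prop }, ?_, ?_⟩
  · refine Prod.ext ?_ ?_ <;> simp only <;> field_simp <;> ring
  · refine Prod.ext ?_ ?_ <;> simp only <;> field_simp <;> ring
  · simp
  · simp

theorem exists_isEdge [T2Space X] (he : IsOpenEmbedding e) {p q : X} (hp : p ∈ range e)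
    (hq : q ∈ range e) : ∃ a K, IsCompact K ∧ K ⊆ range e ∧ IsEdge a p q K := by
  by_cases hpq : p = q
  · exact ⟨0, ∅, isCompact_empty, empty_subset _, hpq ▸ isEdge_zero p ∅⟩
  obtain ⟨u, rfl⟩ := hp
  obtain ⟨v, rfl⟩ := hq
  obtain ⟨A, hA₀, hA₁⟩ := exists_affine_homeomorph fun h => hpq (congrArg e h)
  have hA := he.comp A.isOpenEmbedding
  have h := isEdge_segmentPotential hA (zero_lt_one (α := ℝ))
  simp only [Function.comp_apply, hA₀, hA₁] at h
  refine ⟨_, _, isCompact_segment_image hA 0 1, ?_, h⟩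
  exact (image_subset_range _ _).trans (range_comp_subset_range _ _)

/-! ### The triangle relation and the classes of short arcs -/

variable [ChartedSpace (EuclideanSpace ℝ (Fin 2)) X] [T2Space X]

/-- Each vertex is an endpoint of two of the three sides, so the ramification of the sum cancels mod
2 everywhere. An unramified class with compact support in a plane is trivial. -/
theorem IsEdge.triangle (he : IsOpenEmbedding e) {p q r : X} {a b c : X → X → ZMod 2}
    {K L M : Set X} (hK : IsCompact K) (hL : IsCompact L) (hM : IsCompact M) (hKe : K ⊆ range e)
    (hLe : L ⊆ range e) (hMe : M ⊆ range e) (ha : IsEdge a p q K) (hb : IsEdge b q r L)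
    (hc : IsEdge c p r M) : a + b + c ∈ nullClasses X := by
  have hS : ({p, q, r} : Set X).Finite := by simp
  have ha' : ∀ x ∉ ({p, q, r} : Set X), Coherent (denseInterior X) a x := fun x hx => by
    simp only [mem_insert_iff, mem_singleton_iff, not_or] at hx
    exact ha.coherent x hx.1 hx.2.1
  have hb' : ∀ x ∉ ({p, q, r} : Set X), Coherent (denseInterior X) b x := fun x hx => by
    simp only [mem_insert_iff, mem_singleton_iff, not_or] at hx
    exact hb.coherent x hx.2.1 hx.2.2
  have hc' : ∀ x ∉ ({p, q, r} : Set X), Coherent (denseInterior X) c x := fun x hx => by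
    simp only [mem_insert_iff, mem_singleton_iff, not_or] at hx
    exact hc.coherent x hx.1 hx.2.2
  refine mem_nullClasses_of_support he ((hK.union hL).union hM)
    (union_subset (union_subset hKe hLe) hMe) hS
    (fun x hx => ((ha' x hx).add (hb' x hx)).add (hc' x hx)) (fun x => ?_) fun x hx => ?_
  · have hx := hS.eventually_punctured_notMem x
    rw [← ram_eq_zero, ram_add (hx.mono fun y hy => (ha' y hy).add (hb' y hy)) (hx.mono hc'),
      ram_add (hx.mono ha') (hx.mono hb'), ha.ram_eq, hb.ram_eq, hc.ram_eq]
    generalize pointMass p x = s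
    generalize pointMass q x = t
    generalize pointMass r x = u
    revert s t u
    decide
  · simp only [mem_union, not_or] at hx
    simp [ha.support x hx.1.1, hb.support x hx.1.2, hc.support x hx.2]

/-- The group in which the classes dual to curves live. -/
abbrev DualClass (X : Type*) [TopologicalSpace X] : Type _ := (X → X → ZMod 2) ⧸ nullClasses X

theorem IsEdge.mk_add_mk (he : IsOpenEmbedding e) {p q r : X} {a b c : X → X → ZMod 2}
    {K L M : Set X} (hK : IsCompact K) (hL : IsCompact L) (hM : IsCompact M) (hKe : K ⊆ range e)
    (hLe : L ⊆ range e) (hMe : M ⊆ range e) (ha : IsEdge a p q K) (hb : IsEdge b q r L)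
    (hc : IsEdge c p r M) :
    ((nullClasses X).mkQ a + (nullClasses X).mkQ b : DualClass X) = (nullClasses X).mkQ c := by
  have h := triangle he hK hL hM hKe hLe hMe ha hb hc
  rw [← map_add, ← sub_eq_zero, ← map_sub, Submodule.mkQ_apply, Submodule.Quotient.mk_eq_zero]
  convert h using 1
  rw [sub_eq_iff_eq_add, add_assoc, add_self_zmod_two, add_zero]

/-- A degenerate triangle, whose second side is the zero edge at `q`. -/
theorem IsEdge.mk_eq_mk (he : IsOpenEmbedding e) {p q : X} {a b : X → X → ZMod 2}
    {K L : Set X} (hK : IsCompact K) (hL : IsCompact L) (hKe : K ⊆ range e)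
    (hLe : L ⊆ range e) (ha : IsEdge a p q K) (hb : IsEdge b p q L) :
    ((nullClasses X).mkQ a : DualClass X) = (nullClasses X).mkQ b := by
  simpa using mk_add_mk he hK isCompact_empty hL hKe (empty_subset _) hLe ha (isEdge_zero q ∅) hb

/-- A coordinate plane around `x`. -/
noncomputable def planeAt (x : X) : ℝ × ℝ → X := (exists_plane (x := x) univ_mem).choose

theorem isOpenEmbedding_planeAt (x : X) : IsOpenEmbedding (planeAt x) :=
  (exists_plane (x := x) univ_mem).choose_spec.1

theorem mem_range_planeAt (x : X) : x ∈ range (planeAt x) :=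
  ⟨0, (exists_plane (x := x) univ_mem).choose_spec.2.1⟩

theorem range_planeAt_mem_nhds (x : X) : range (planeAt x) ∈ 𝓝 x :=
  (isOpenEmbedding_planeAt x).isOpen_range.mem_nhds (mem_range_planeAt x)

open Classical in
/-- The class of a short arc from `x` to `y`. -/
noncomputable def edgeClass (x y : X) : DualClass X :=
  if h : y ∈ range (planeAt x) then
    (nullClasses X).mkQ (exists_isEdge (isOpenEmbedding_planeAt x) (mem_range_planeAt x) h).choose
  else 0

theorem edgeClass_eq {x y : X} {a : X → X → ZMod 2} {K : Set X} (hK : IsCompact K)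
    (hKe : K ⊆ range (planeAt x)) (hy : y ∈ range (planeAt x)) (ha : IsEdge a x y K) :
    edgeClass x y = (nullClasses X).mkQ a := by
  rw [edgeClass, dif_pos hy]
  obtain ⟨L, hL, hLe, hb⟩ :=
    (exists_isEdge (isOpenEmbedding_planeAt x) (mem_range_planeAt x) hy).choose_spec
  exact IsEdge.mk_eq_mk (isOpenEmbedding_planeAt x) hL hK hLe hKe hb ha

theorem edgeClass_self (x : X) : edgeClass x x = 0 := by
  rw [edgeClass_eq isCompact_empty (empty_subset _) (mem_range_planeAt x)
    (isEdge_zero x ∅), map_zero]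

/-- The local cocycle relation. An edge from `y` to `w` inside both `planeAt x` and `planeAt y`
computes `edgeClass y w` and is at the same time the third side of a triangle in `planeAt x`. -/
theorem edgeClass_eventually (x : X) :
    ∀ᶠ y in 𝓝 x, ∀ᶠ w in 𝓝 y, edgeClass x w - edgeClass y w = edgeClass x y := by
  filter_upwards [(isOpenEmbedding_planeAt x).isOpen_range.mem_nhds (mem_range_planeAt x)] with y hy
  obtain ⟨e, he, rfl, hsub⟩ := exists_plane (x := y) (inter_mem
    ((isOpenEmbedding_planeAt x).isOpen_range.mem_nhds hy) (range_planeAt_mem_nhds y))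
  filter_upwards [he.isOpen_range.mem_nhds ⟨0, rfl⟩] with w hw
  obtain ⟨a, K, hK, hKe, ha⟩ := exists_isEdge he ⟨0, rfl⟩ hw
  obtain ⟨b, L, hL, hLe, hb⟩ :=
    exists_isEdge (isOpenEmbedding_planeAt x) (mem_range_planeAt x) hy
  obtain ⟨c, M, hM, hMe, hc⟩ :=
    exists_isEdge (isOpenEmbedding_planeAt x) (mem_range_planeAt x) (hsub hw).1
  rw [edgeClass_eq hK (fun z hz => (hsub (hKe hz)).2) (hsub hw).2 ha, edgeClass_eq hL hLe hy hb,
    edgeClass_eq hM hMe (hsub hw).1 hc, sub_eq_iff_eq_add]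
  exact (IsEdge.mk_add_mk (isOpenEmbedding_planeAt x) hL hK hM hLe
    (fun z hz => (hsub (hKe hz)).1) hMe hb ha hc).symm

/-- The class swept out by a continuous map from the plane: the periods of a homotopy of loops do
not depend on time. -/
theorem exists_lift_edgeClass {H : ℝ × ℝ → X} (hH : Continuous H) :
    ∃ φ : ℝ × ℝ → DualClass X, ∀ y, ∃ c, ∀ᶠ z in 𝓝 y, φ z - edgeClass (H y) (H z) = c := by
  -- The pullback of the cocycle is a coherent family on the plane. With the filter `⊤`, locally
  -- constant has its literal meaning here.
  obtain ⟨φ, hφ⟩ := hasPotential_range (ℓ := (⊤ : Filter (ℝ × ℝ))) isLocalFilter_top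
    (a := fun y z => edgeClass (H y) (H z)) IsOpenEmbedding.id fun y => by
      have := hH.continuousAt.eventually (edgeClass_eventually (H y))
      filter_upwards [this] with z hz
      refine ⟨edgeClass (H y) (H z), ?_⟩
      rw [inf_top_eq]
      exact hH.continuousAt.eventually hz
  refine ⟨φ, fun y => ?_⟩
  simpa [EvConst] using hφ y (by simp)

end Edges

/-! ### The class dual to a component of a link projection -/

section Jumps

variable {X : Type*} [TopologicalSpace X] {e : ℝ × ℝ → X}

/-- The function is almost everywhere constant on the upper and on the lower half of a small box,
and the axis between them is nowhere dense. -/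
theorem exists_jump (he : IsOpenEmbedding e) {w : ℝ × ℝ} (hw : w.2 = 0) {f : X → ZMod 2}
    (hf : ∀ᶠ q in 𝓝 w, q.2 ≠ 0 → EvConst (denseInterior X) (e q) f) :
    ∃ j : ZMod 2, EvConst (denseInterior X) (e w) (f - j • upperSide e) := by
  have hL := isLocalFilter_denseInterior (X := X)
  obtain ⟨δ, hδ, hb⟩ := Metric.eventually_nhds_iff_ball.1 hf
  have hball : Metric.ball w δ = Ioo (w.1 - δ) (w.1 + δ) ×ˢ Ioo (-δ) δ := by
    obtain ⟨w₁, w₂⟩ := w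
    obtain rfl : w₂ = 0 := hw
    rw [← ball_prod_same, Real.ball_eq_Ioo, Real.ball_eq_Ioo, zero_sub, zero_add]
  have hconst : ∀ u v : ℝ, -δ ≤ u → v ≤ δ → (0 ≤ u ∨ v ≤ 0) →
      ∃ c, ∀ᶠ y in denseInterior X, y ∈ e '' (Ioo (w.1 - δ) (w.1 + δ) ×ˢ Ioo u v) → f y = c := by
    intro u v hu hv huv
    obtain ⟨c, hc⟩ := hL.exists_const (h := f)
      (((isPreconnected_Ioo (a := w.1 - δ) (b := w.1 + δ)).prod
      (isPreconnected_Ioo (a := u) (b := v))).image e he.continuous.continuousOn) (by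
        rintro _ ⟨q, ⟨h₁, h₂⟩, rfl⟩
        refine hb q (hball ▸ ⟨h₁, hu.trans_lt h₂.1, h₂.2.trans_le hv⟩) ?_
        rcases huv with h | h
        · exact (h.trans_lt h₂.1).ne'
        · exact (h₂.2.trans_le h).ne)
    exact ⟨c, hL.of_forall _ _ (he.isOpenMap _ (isOpen_Ioo.prod isOpen_Ioo)) hc⟩
  obtain ⟨c, hc⟩ := hconst 0 δ (by linarith) le_rfl (.inl le_rfl)
  obtain ⟨d, hd⟩ := hconst (-δ) 0 le_rfl hδ.le (.inr le_rfl)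
  refine ⟨c - d, d, ?_⟩
  filter_upwards [mem_inf_of_right hc, mem_inf_of_right hd, mem_inf_of_right (axis_compl_mem he),
    mem_inf_of_left (he.image_mem_nhds.2 (Metric.ball_mem_nhds w hδ))] with y hyc hyd hy0 hy
  obtain ⟨q, hq, rfl⟩ := hy
  rw [hball] at hq
  have hq0 : q.2 ≠ 0 := fun h => hy0 ⟨q, h, rfl⟩
  rcases lt_or_gt_of_ne hq0 with h | h
  · simp [upperSide_of_nonpos he h.le, hyd ⟨q, ⟨hq.1, hq.2.1, h⟩, rfl⟩]
  · simp [upperSide_of_pos h, hyc ⟨q, ⟨hq.1, h, hq.2.2⟩, rfl⟩]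

theorem not_evConst_upperSide (he : IsOpenEmbedding e) {w : ℝ × ℝ} (hw : w.2 = 0) :
    ¬ EvConst (denseInterior X) (e w) (upperSide e) := by
  intro h
  have := jump_eq he hw (f := upperSide e) (j := 0) (c := 1) (d := 0) (by simpa using h)
    (.of_forall fun q hq => Eventually.filter_mono inf_le_left (by
      simpa [upperSide_of_pos hq] using eventually_upperSide he hq.ne'))
    (.of_forall fun q hq => Eventually.filter_mono inf_le_left (by
      simpa [upperSide_of_nonpos he hq.le] using eventually_upperSide he hq.ne))
  revert this
  decide

/-- Two coordinate planes in which the set `A` is the horizontal axis have the same sides, up to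
interchange. -/
theorem upperSide_compat {e₁ e₂ : ℝ × ℝ → X} (h₁ : IsOpenEmbedding e₁) (h₂ : IsOpenEmbedding e₂)
    {w₁ w₂ : ℝ × ℝ} (hw : e₁ w₁ = e₂ w₂) (hw₁ : w₁.2 = 0) (hw₂ : w₂.2 = 0) {A : Set X}
    (hA₁ : ∀ᶠ q in 𝓝 w₁, e₁ q ∈ A ↔ q.2 = 0) (hA₂ : ∀ᶠ q in 𝓝 w₂, e₂ q ∈ A ↔ q.2 = 0) :
    EvConst (denseInterior X) (e₁ w₁) (upperSide e₁ - upperSide e₂) := by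
  obtain ⟨j, hj⟩ := exists_jump h₂ hw₂ (f := upperSide e₁) (by
    have h := h₁.image_mem_nhds.2 hA₁
    rw [hw] at h
    filter_upwards [hA₂, h₂.continuous.continuousAt.preimage_mem_nhds h] with q hq hq' hq0
    obtain ⟨q', hq', hqq⟩ := hq'
    rw [← hqq]
    refine evConst_upperSide h₁ fun h => hq0 (hq.1 ?_)
    rw [← hqq]
    exact hq'.2 h)
  rw [← hw] at hj
  -- Jump 0 would make `upperSide e₁` almost everywhere constant near a point of its own axis.
  have hj1 : j = 1 := by
    have : ∀ j : ZMod 2, j = 0 ∨ j = 1 := by decide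
    refine (this j).resolve_left ?_
    rintro rfl
    exact not_evConst_upperSide h₁ hw₁ (by simpa using hj)
  simpa [hj1] using hj

end Jumps

/-! ### Flat strands and the potentials of their sides -/

namespace LinkProjection

section Strands

variable {n : ℕ} {X : Type*} [TopologicalSpace X] (P : LinkProjection n X)

/-- The parameter `z` belongs to a crossing. -/
def IsDouble (z : Circles n) : Prop := ∃ w, w ≠ z ∧ P.curve w = P.curve z

/-- The set of crossing points. -/
def crossings : Set X := {p | ∃ z w, z ≠ w ∧ P.curve z = p ∧ P.curve w = p}

variable {P}

theorem IsDouble.mem_crossings {z : Circles n} (h : P.IsDouble z) : P.curve z ∈ P.crossings := by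
  obtain ⟨w, hw, h⟩ := h
  exact ⟨w, z, hw, h, rfl⟩

theorem isDouble_iff {z : Circles n} : P.IsDouble z ↔ P.curve z ∈ P.crossings := by
  refine ⟨IsDouble.mem_crossings, ?_⟩
  rintro ⟨w, v, hwv, hw, hv⟩
  by_cases h : w = z
  · exact ⟨v, fun h' => hwv (h.trans h'.symm), hv⟩
  · exact ⟨w, h, hw⟩

theorem finite_isDouble : {z | P.IsDouble z}.Finite := by
  have h : {z | P.IsDouble z} = P.curve ⁻¹' P.crossings := by
    ext z
    exact isDouble_iff
  rw [h]
  refine P.finite_double.preimage' ?_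
  rintro p ⟨z, w, hzw, hz, hw⟩
  refine (toFinite {z, w}).subset fun v hv => ?_
  have hv' : P.curve v = p := hv
  rcases P.double z w v (hz.trans hw.symm) (hw.trans hv'.symm) with h | h | h
  · exact (hzw h).elim
  · simp [h]
  · simp [h]

theorem eventually_not_isDouble (z : Circles n) : ∀ᶠ v in 𝓝[≠] z, ¬ P.IsDouble v :=
  finite_isDouble.eventually_punctured_notMem z

theorem exists_arcChart {z : Circles n} (hz : ¬ P.IsDouble z) :
    ∃ e, IsArcChart (range P.curve) (P.curve z) e := by
  refine P.regular z fun w hw => ?_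
  by_contra h
  exact hz ⟨w, h, hw⟩

/-- Every strand is flat, also at the crossings. -/
theorem exists_strandChart (z : Circles n) : ∃ e : ℝ × ℝ → X, IsOpenEmbedding e ∧
    e 0 = P.curve z ∧ (∀ᶠ v in 𝓝 z, P.curve v ∈ e '' {q | q.2 = 0}) ∧
    ∀ t : ℝ, t ≠ 0 → ∀ᶠ q in 𝓝 ((t, 0) : ℝ × ℝ), e q ∈ range P.curve ↔ q.2 = 0 := by
  by_cases hz : P.IsDouble z
  · obtain ⟨w, hw, hwz⟩ := hz
    obtain ⟨e, ⟨he, he0, hr⟩, h, -⟩ := P.transverse z w hw.symm hwz.symm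
    refine ⟨e, he, he0, h, fun t ht => ?_⟩
    filter_upwards [(isOpen_ne_fun continuous_fst continuous_const).mem_nhds ht] with q hq
    have : e q ∈ range P.curve ↔ q.1 = 0 ∨ q.2 = 0 := Set.ext_iff.1 hr q
    rw [this]
    exact or_iff_right hq
  · obtain ⟨e, he, he0, hr⟩ := exists_arcChart hz
    have hr' : ∀ q, e q ∈ range P.curve ↔ q.2 = 0 := Set.ext_iff.1 hr
    refine ⟨e, he, he0, ?_, fun t _ => .of_forall hr'⟩
    have : range e ∈ 𝓝 (P.curve z) := he.isOpen_range.mem_nhds ⟨0, he0⟩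
    filter_upwards [P.curve.continuous.continuousAt.preimage_mem_nhds this] with v hv
    obtain ⟨q, hq⟩ := hv
    exact ⟨q, (hr' q).1 ⟨v, hq.symm⟩, hq⟩

open Classical in
/-- One of the two sides of the projection near the point `p`. -/
noncomputable def side (P : LinkProjection n X) (p : X) : X → ZMod 2 :=
  if h : ∃ e, IsArcChart (range P.curve) p e then upperSide h.choose else 0

theorem exists_side_eq {z : Circles n} (hz : ¬ P.IsDouble z) :
    ∃ e, IsArcChart (range P.curve) (P.curve z) e ∧ P.side (P.curve z) = upperSide e := by
  have h := exists_arcChart hz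
  exact ⟨h.choose, h.choose_spec, dif_pos h⟩

/-- The arbitrary chart behind `P.side` is harmless: any chart in which the projection is the axis
has the same side up to a constant. -/
theorem side_compat {z : Circles n} (hz : ¬ P.IsDouble z) {e : ℝ × ℝ → X}
    (he : IsOpenEmbedding e) {w : ℝ × ℝ} (hw : e w = P.curve z) (hw0 : w.2 = 0)
    (h : ∀ᶠ q in 𝓝 w, e q ∈ range P.curve ↔ q.2 = 0) :
    EvConst (denseInterior X) (P.curve z) (P.side (P.curve z) - upperSide e) := by
  obtain ⟨e', ⟨he', he'0, hr⟩, hs⟩ := exists_side_eq hz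
  rw [hs, ← he'0]
  exact upperSide_compat he' he (he'0.trans hw.symm) rfl hw0
    (.of_forall (Set.ext_iff.1 hr)) h

open Classical in
/-- The class dual to the `i`-th component. -/
noncomputable def componentPotential (P : LinkProjection n X) (i : Fin n) : X → X → ZMod 2 :=
  fun p => if ∃ ζ, P.curve (i, ζ) = p ∧ ¬ P.IsDouble (i, ζ) then P.side p else 0

/-- The universal covering of the `i`-th circle. -/
noncomputable def circleParam (i : Fin n) (t : ℝ) : Circles n := (i, Circle.exp t)

theorem continuous_circleParam (i : Fin n) : Continuous (circleParam i) :=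
  continuous_const.prodMk Circle.exp.continuous

theorem circleParam_injOn (i : Fin n) {s t : ℝ} (h : |s - t| < 2 * Real.pi)
    (hst : circleParam i s = circleParam i t) : s = t := by
  obtain ⟨m, hm⟩ := Circle.exp_eq_exp.1 (congrArg Prod.snd hst)
  have : |(m : ℝ)| * (2 * Real.pi) < 1 * (2 * Real.pi) := by
    rw [one_mul]
    have e : s - t = m * (2 * Real.pi) := by linarith
    rwa [e, abs_mul, abs_of_pos Real.two_pi_pos] at h
  have hm0 := lt_of_mul_lt_mul_right this Real.two_pi_pos.le
  have : |m| < 1 := by exact_mod_cast hm0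
  rw [Int.abs_lt_one_iff.1 this] at hm
  simpa using hm

open Classical in
/-- The class dual to the part of the `i`-th component with parameters between `0` and `t`. -/
noncomputable def partialPotential (P : LinkProjection n X) (i : Fin n) (t : ℝ) :
    X → X → ZMod 2 :=
  fun p => if ∃ τ ∈ Ioo 0 t, P.curve (circleParam i τ) = p ∧ ¬ P.IsDouble (circleParam i τ)
    then P.side p else 0

variable (P)

theorem partialPotential_zero (i : Fin n) : P.partialPotential i 0 = 0 := by
  funext p
  refine if_neg ?_
  rintro ⟨τ, hτ, -⟩
  exact lt_asymm hτ.1 hτ.2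

/-- The open parameter interval misses only the base point, and null classes ignore finite sets. -/
theorem partialPotential_two_pi [T1Space X] (i : Fin n) :
    ((nullClasses X).mkQ (P.partialPotential i (2 * Real.pi)) : DualClass X) =
      (nullClasses X).mkQ (P.componentPotential i) := by
  rw [← sub_eq_zero, ← map_sub, Submodule.mkQ_apply, Submodule.Quotient.mk_eq_zero]
  refine ⟨{P.curve (circleParam i 0)}, finite_singleton _, 0, fun p hp => ?_⟩
  have hp' : p ≠ P.curve (circleParam i 0) := hp
  have : P.partialPotential i (2 * Real.pi) p = P.componentPotential i p := by
    unfold partialPotential componentPotential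
    congr 1
    refine propext ⟨?_, ?_⟩
    · rintro ⟨τ, -, h⟩
      exact ⟨_, h⟩
    · rintro ⟨ζ, hζ, hd⟩
      obtain ⟨τ, hτ, rfl⟩ : ∃ τ ∈ Ico 0 (2 * Real.pi), Circle.exp τ = ζ := by
        refine ⟨toIcoMod Real.two_pi_pos 0 (Complex.arg ζ), ?_, ?_⟩
        · simpa using toIcoMod_mem_Ico Real.two_pi_pos 0 (Complex.arg ζ)
        · rw [toIcoMod, zsmul_eq_mul, Circle.exp_sub, Circle.exp_int_mul_two_pi, div_one,
            Circle.exp_arg]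
      refine ⟨τ, ⟨lt_of_le_of_ne hτ.1 ?_, hτ.2⟩, hζ, hd⟩
      rintro rfl
      exact hp' hζ.symm
  rw [Pi.sub_apply, this, sub_self, sub_zero]
  exact .zero

variable {P}

/-- A flat arc of the projection represents the class of a segment. -/
theorem partialPotential_sub {i : Fin n} {s t : ℝ} (hs : 0 ≤ s) (hst : s < t)
    (ht : t ≤ 2 * Real.pi) {e : ℝ × ℝ → X} (he : IsOpenEmbedding e) {x : ℝ → ℝ}
    (hx : ContinuousOn x (Icc s t)) (hinj : InjOn x (Icc s t))
    (hcurve : ∀ τ ∈ Icc s t, P.curve (circleParam i τ) = e (x τ, 0))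
    (hd : ∀ τ ∈ Ioo s t, ¬ P.IsDouble (circleParam i τ))
    (hflat : ∀ τ ∈ Ioo s t, ∀ᶠ q in 𝓝 (x τ, (0 : ℝ)), e q ∈ range P.curve ↔ q.2 = 0) :
    ((nullClasses X).mkQ (P.partialPotential i t) -
        (nullClasses X).mkQ (P.partialPotential i s) : DualClass X) =
      (nullClasses X).mkQ (segmentPotential e (min (x s) (x t)) (max (x s) (x t))) := by
  -- A continuous injective coordinate is strictly monotone, so the arc runs through the segment
  -- once.
  have himage : x '' Ioo s t = Ioo (min (x s) (x t)) (max (x s) (x t)) := by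
    rcases hx.strictMonoOn_of_injOn_Icc' hst.le hinj with h | h
    · rw [hx.image_Ioo_of_strictMonoOn hst.le h]
      have := (h (left_mem_Icc.2 hst.le) (right_mem_Icc.2 hst.le) hst).le
      rw [min_eq_left this, max_eq_right this]
    · rw [hx.image_Ioo_of_strictAntiOn hst.le h]
      have := (h (left_mem_Icc.2 hst.le) (right_mem_Icc.2 hst.le) hst).le
      rw [min_eq_right this, max_eq_left this]
  rw [← sub_eq_zero, ← map_sub, ← map_sub, Submodule.mkQ_apply, Submodule.Quotient.mk_eq_zero]
  -- Besides the crossings, the point with parameter `s` is excluded: it is an end of the segment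
  -- and lies in neither of the open intervals `(0, s)` and `(s, t)`.
  refine ⟨P.crossings ∪ {P.curve (circleParam i s)}, P.finite_double.union (finite_singleton _), 0,
    fun p hp => ?_⟩
  simp only [mem_compl_iff, mem_union, mem_singleton_iff, not_or] at hp
  by_cases hτ : ∃ τ ∈ Ioo s t, P.curve (circleParam i τ) = p
  · obtain ⟨τ, hτ, rfl⟩ := hτ
    have e₁ : P.partialPotential i t (P.curve (circleParam i τ)) =
        P.side (P.curve (circleParam i τ)) :=
      if_pos ⟨τ, ⟨hs.trans_lt hτ.1, hτ.2⟩, rfl, hd τ hτ⟩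
    have e₂ : P.partialPotential i s (P.curve (circleParam i τ)) = 0 := by
      refine if_neg ?_
      rintro ⟨σ, hσ, h, -⟩
      refine hd τ hτ ⟨_, fun h' => ?_, h⟩
      have := circleParam_injOn i (abs_lt.2 ⟨by linarith [hσ.1, hτ.2], by linarith [hσ.2, hτ.1]⟩) h'
      linarith [hσ.2, hτ.1]
    have hmem := himage ▸ mem_image_of_mem x hτ
    have e₃ : segmentPotential e (min (x s) (x t)) (max (x s) (x t))
        (P.curve (circleParam i τ)) = upperSide e := by
      rw [hcurve τ (Ioo_subset_Icc_self hτ)]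
      exact segmentPotential_of_mem ⟨hmem.1, hmem.2, rfl⟩
    have := side_compat (hd τ hτ) he (hcurve τ (Ioo_subset_Icc_self hτ)).symm rfl (hflat τ hτ)
    simpa [e₁, e₂, e₃] using this.neg
  · have e₃ : segmentPotential e (min (x s) (x t)) (max (x s) (x t)) p = 0 := by
      refine if_neg ?_
      rintro ⟨q, ⟨h₁, h₂, h₃⟩, rfl⟩
      obtain ⟨τ, hτ', hxτ⟩ := himage.symm ▸ (show q.1 ∈ Ioo _ _ from ⟨h₁, h₂⟩)
      exact hτ ⟨τ, hτ', (hcurve τ (Ioo_subset_Icc_self hτ')).trans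
        (congrArg e (Prod.ext hxτ h₃.symm))⟩
    have e₁ : P.partialPotential i t p = P.partialPotential i s p := by
      unfold partialPotential
      congr 1
      refine propext ⟨?_, ?_⟩
      · rintro ⟨σ, hσ, h, h'⟩
        refine ⟨σ, ⟨hσ.1, ?_⟩, h, h'⟩
        rcases lt_trichotomy σ s with h'' | rfl | h''
        · exact h''
        · exact (hp.2 h.symm).elim
        · exact (hτ ⟨σ, ⟨h'', hσ.2⟩, h⟩).elim
      · rintro ⟨σ, hσ, h⟩
        exact ⟨σ, ⟨hσ.1, hσ.2.trans hst⟩, h⟩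
    rw [Pi.sub_apply, Pi.sub_apply, e₁, e₃, sub_self, sub_zero, sub_zero]
    exact .zero

end Strands

end LinkProjection

/-! ### Homotopy invariance of the dual classes -/

namespace LinkProjection

section Homotopy

variable {n : ℕ} {X : Type*} [TopologicalSpace X] [T2Space X]
  [ChartedSpace (EuclideanSpace ℝ (Fin 2)) X] {P : LinkProjection n X}

/-- In a strand chart a short piece of the component is a segment of the axis, so the class it adds
is that of an edge between its endpoints. -/
theorem partialPotential_eventually (i : Fin n) {t₀ : ℝ} (ht₀ : t₀ ∈ Icc 0 (2 * Real.pi)) :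
    ∀ᶠ t in 𝓝[Icc 0 (2 * Real.pi)] t₀,
      ((nullClasses X).mkQ (P.partialPotential i t) -
          (nullClasses X).mkQ (P.partialPotential i t₀) : DualClass X) =
        edgeClass (P.curve (circleParam i t₀)) (P.curve (circleParam i t)) := by
  obtain ⟨e, he, he0, haxis, hflat⟩ := P.exists_strandChart (circleParam i t₀)
  let E := he.toOpenPartialHomeomorph e
  have hE : ∀ q, E.symm (e q) = q := fun q => E.left_inv (by simp [E])
  let x : ℝ → ℝ := fun t => (E.symm (P.curve (circleParam i t))).1
  have hx₀ : x t₀ = 0 := by simp [x, ← he0, hE]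
  have hcont : ∀ t, P.curve (circleParam i t) ∈ range e → ContinuousAt x t := by
    intro t ht
    have h₁ : ContinuousAt E.symm (P.curve (circleParam i t)) :=
      E.continuousAt_symm (by simpa [E] using ht)
    have h₂ : ContinuousAt (fun t => P.curve (circleParam i t)) t :=
      (P.curve.continuous.comp (continuous_circleParam i)).continuousAt
    exact continuousAt_fst.comp (ContinuousAt.comp (f := fun t => P.curve (circleParam i t)) h₁ h₂)
  have hcx : ∀ t, P.curve (circleParam i t) ∈ e '' {q | q.2 = 0} →
      P.curve (circleParam i t) = e (x t, 0) := by
    rintro t ⟨q, hq, h⟩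
    simp only [x, ← h, hE]
    exact congrArg e (Prod.ext rfl hq)
  have hnear₁ : ∀ᶠ t in 𝓝 t₀, P.curve (circleParam i t) ∈ e '' {q | q.2 = 0} :=
    (continuous_circleParam i).continuousAt.eventually haxis
  have hnear₂ : ∀ᶠ t in 𝓝 t₀, circleParam i t ≠ circleParam i t₀ →
      ¬ P.IsDouble (circleParam i t) :=
    (continuous_circleParam i).continuousAt.eventually
      (eventually_nhdsWithin_iff.1 (eventually_not_isDouble (circleParam i t₀)))
  have hpl : e ⁻¹' range (planeAt (P.curve (circleParam i t₀))) ∈ 𝓝 0 :=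
    he.continuous.continuousAt.preimage_mem_nhds (he0 ▸ range_planeAt_mem_nhds _)
  obtain ⟨r, hr, hball⟩ := Metric.mem_nhds_iff.1 hpl
  have hnear₃ : ∀ᶠ t in 𝓝 t₀, |x t| < r := by
    have h := (hcont t₀ ⟨0, he0⟩).abs.tendsto
    rw [hx₀, abs_zero] at h
    exact h.eventually (eventually_lt_nhds hr)
  obtain ⟨δ, hδ, hb⟩ := Metric.eventually_nhds_iff_ball.1 (hnear₁.and (hnear₂.and hnear₃))
  -- One endpoint is `t₀`, the only nearby parameter that can belong to a crossing, so the open arc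
  -- contains no crossing.
  have key : ∀ s t, 0 ≤ s → s < t → t ≤ 2 * Real.pi → (s = t₀ ∨ t = t₀) →
      (∀ τ ∈ Icc s t, τ ∈ Metric.ball t₀ (min δ Real.pi)) →
      ∃ K, IsCompact K ∧ K ⊆ range (planeAt (P.curve (circleParam i t₀))) ∧ ∃ a,
        IsEdge a (P.curve (circleParam i s)) (P.curve (circleParam i t)) K ∧
        ((nullClasses X).mkQ (P.partialPotential i t) -
          (nullClasses X).mkQ (P.partialPotential i s) : DualClass X) = (nullClasses X).mkQ a := by
    intro s t hs hst ht hend hI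
    have hIδ : ∀ τ ∈ Icc s t, τ ∈ Metric.ball t₀ δ := fun τ hτ =>
      Metric.ball_subset_ball (min_le_left _ _) (hI τ hτ)
    have hIπ : ∀ τ ∈ Icc s t, |τ - t₀| < Real.pi := fun τ hτ =>
      Metric.ball_subset_ball (min_le_right _ _) (hI τ hτ)
    have hne : ∀ τ ∈ Icc s t, τ ≠ t₀ → ¬ P.IsDouble (circleParam i τ) := fun τ hτ hτ₀ =>
      (hb τ (hIδ τ hτ)).2.1 fun h => hτ₀ (circleParam_injOn i
        ((hIπ τ hτ).trans (by linarith [Real.pi_pos])) h)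
    have hc : ∀ τ ∈ Icc s t, P.curve (circleParam i τ) = e (x τ, 0) := fun τ hτ =>
      hcx τ (hb τ (hIδ τ hτ)).1
    -- Equal coordinates at two parameters would make both of them double, and at least one differs
    -- from `t₀`.
    have hinj : InjOn x (Icc s t) := by
      intro σ hσ τ hτ h
      by_contra hστ
      have hcr : P.curve (circleParam i σ) = P.curve (circleParam i τ) := by
        rw [hc σ hσ, hc τ hτ, h]
      have hpar : circleParam i σ ≠ circleParam i τ := fun h => hστ (circleParam_injOn i (by
        have h₁ := abs_lt.1 (hIπ σ hσ)
        have h₂ := abs_lt.1 (hIπ τ hτ)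
        exact abs_lt.2 ⟨by linarith, by linarith⟩) h)
      by_cases hσ₀ : σ = t₀
      · exact hne τ hτ (fun h => hστ (hσ₀.trans h.symm)) ⟨_, hpar, hcr⟩
      · exact hne σ hσ hσ₀ ⟨_, hpar.symm, hcr.symm⟩
    have hmemt₀ : t₀ ∈ Icc s t := by
      rcases hend with h | h
      · exact h ▸ left_mem_Icc.2 hst.le
      · exact h ▸ right_mem_Icc.2 hst.le
    have hoo : ∀ τ ∈ Ioo s t, τ ≠ t₀ := by
      rintro τ hτ rfl
      rcases hend with h | h
      · exact hτ.1.ne h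
      · exact hτ.2.ne' h
    have hlt : min (x s) (x t) < max (x s) (x t) := by
      rw [min_lt_max]
      exact fun h => hst.ne (hinj (left_mem_Icc.2 hst.le) (right_mem_Icc.2 hst.le) h)
    refine ⟨_, isCompact_segment_image he (min (x s) (x t)) (max (x s) (x t)), ?_,
      segmentPotential e (min (x s) (x t)) (max (x s) (x t)), ?_, ?_⟩
    · rintro _ ⟨q, ⟨hq₁, hq₂⟩, rfl⟩
      refine hball ?_
      have hxs := abs_lt.1 (hb s (hIδ s (left_mem_Icc.2 hst.le))).2.2
      have hxt := abs_lt.1 (hb t (hIδ t (right_mem_Icc.2 hst.le))).2.2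
      have hq₂' : q.2 = 0 := hq₂
      rw [mem_ball_zero_iff, Prod.norm_def, hq₂', norm_zero, max_lt_iff]
      refine ⟨abs_lt.2 ⟨?_, ?_⟩, hr⟩
      · exact (lt_min hxs.1 hxt.1).trans_le hq₁.1
      · exact hq₁.2.trans_lt (max_lt hxs.2 hxt.2)
    · have h := isEdge_segmentPotential he hlt
      rcases le_total (x s) (x t) with h' | h'
      · rw [min_eq_left h', max_eq_right h'] at h ⊢
        rwa [hc s (left_mem_Icc.2 hst.le), hc t (right_mem_Icc.2 hst.le)]
      · rw [min_eq_right h', max_eq_left h'] at h ⊢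
        rw [hc s (left_mem_Icc.2 hst.le), hc t (right_mem_Icc.2 hst.le)]
        exact h.symm
    · refine partialPotential_sub hs hst ht he (fun τ hτ => (hcont τ ?_).continuousWithinAt) hinj
        hc (fun τ hτ => hne τ (Ioo_subset_Icc_self hτ) (hoo τ hτ)) fun τ hτ => hflat _ fun h => ?_
      · exact ⟨_, (hc τ hτ).symm⟩
      · exact hoo τ hτ (hinj (Ioo_subset_Icc_self hτ) hmemt₀ (h.trans hx₀.symm))
  have hplane : ∀ᶠ t in 𝓝 t₀, P.curve (circleParam i t) ∈
      range (planeAt (P.curve (circleParam i t₀))) :=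
    (P.curve.continuous.comp (continuous_circleParam i)).continuousAt.eventually
      (range_planeAt_mem_nhds _)
  filter_upwards [nhdsWithin_le_nhds (Metric.ball_mem_nhds t₀ (lt_min hδ Real.pi_pos)),
    self_mem_nhdsWithin, nhdsWithin_le_nhds hplane] with t ht htI htp
  have hconv : ∀ τ, (τ ∈ Icc t₀ t ∨ τ ∈ Icc t t₀) → τ ∈ Metric.ball t₀ (min δ Real.pi) := by
    intro τ hτ
    rw [Real.ball_eq_Ioo] at ht ⊢
    have := lt_min hδ Real.pi_pos
    rcases hτ with h | h
    · exact ⟨by linarith [h.1], by linarith [h.2, ht.2]⟩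
    · exact ⟨by linarith [h.1, ht.1], by linarith [h.2]⟩
  rcases lt_trichotomy t₀ t with h | rfl | h
  · obtain ⟨K, hK, hKe, a, ha, hcl⟩ := key t₀ t ht₀.1 h htI.2 (.inl rfl)
      fun τ hτ => hconv τ (.inl hτ)
    rw [hcl, edgeClass_eq hK hKe htp ha]
  · rw [sub_self, edgeClass_self]
  · obtain ⟨K, hK, hKe, a, ha, hcl⟩ := key t t₀ htI.1 h ht₀.2 (.inr rfl)
      fun τ hτ => hconv τ (.inr hτ)
    -- Running backwards changes neither the edge nor, in characteristic two, the sign of its class.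
    rw [← neg_sub, hcl, edgeClass_eq hK hKe htp ha.symm, ZModModule.neg_eq_self]

/-- The class of the `i`-th component as a period. -/
theorem period_eq (i : Fin n) {φ : ℝ → DualClass X}
    (hφ : ∀ t, ∃ c, ∀ᶠ s in 𝓝 t, φ s -
      edgeClass (P.curve (circleParam i t)) (P.curve (circleParam i s)) = c) :
    φ (2 * Real.pi) - φ 0 = (nullClasses X).mkQ (P.componentPotential i) := by
  -- Near each parameter both terms grow by the same `edgeClass`, so the difference is locally
  -- constant on the closed interval.
  let g : ℝ → DualClass X := fun t => φ t - (nullClasses X).mkQ (P.partialPotential i t)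
  let _ : TopologicalSpace (DualClass X) := ⊥
  have : DiscreteTopology (DualClass X) := ⟨rfl⟩
  have hg : ContinuousOn g (Icc 0 (2 * Real.pi)) := by
    intro t ht
    refine tendsto_nhds_of_eventually_eq ?_
    obtain ⟨c, hc⟩ := hφ t
    have hct := hc.self_of_nhds
    rw [edgeClass_self, sub_zero] at hct
    filter_upwards [nhdsWithin_le_nhds hc, P.partialPotential_eventually i ht] with s hs hs'
    simp only [g]
    rw [← hs', ← hct] at hs
    rw [sub_eq_sub_iff_add_eq_add]
    rw [sub_eq_iff_eq_add] at hs
    rw [hs]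
    abel
  have h := isPreconnected_Icc.constant hg (right_mem_Icc.2 Real.two_pi_pos.le)
    (left_mem_Icc.2 Real.two_pi_pos.le)
  simp only [g, partialPotential_zero, map_zero, sub_zero] at h
  rw [← h, sub_sub_cancel, partialPotential_two_pi]

/-- The periods at times 0 and 1 of one lift `φ` are the two classes. The homotopy is periodic, so
`φ` and its translate by `2π` have the same local increments; their difference is locally constant
on the plane, hence independent of time. -/
theorem componentPotential_homotopic {P' : LinkProjection n X} (h : P.curve.Homotopic P'.curve)
    (i : Fin n) : ((nullClasses X).mkQ (P.componentPotential i) : DualClass X) =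
      (nullClasses X).mkQ (P'.componentPotential i) := by
  obtain ⟨F⟩ := h
  -- Clamping the time to the unit interval extends the homotopy to the whole plane.
  let H : ℝ × ℝ → X := fun y => F (projIcc 0 1 zero_le_one y.2, circleParam i y.1)
  have hH : Continuous H := by
    have := continuous_circleParam i
    exact F.continuous.comp ((continuous_projIcc.comp continuous_snd).prodMk
      (this.comp continuous_fst))
  have hper : ∀ t s, H (t + 2 * Real.pi, s) = H (t, s) := fun t s => by
    simp [H, circleParam]
  obtain ⟨φ, hφ⟩ := exists_lift_edgeClass hH
  have hslice : ∀ (s : ℝ) (t : ℝ), ∃ c, ∀ᶠ t' in 𝓝 t,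
      φ (t', s) - edgeClass (H (t, s)) (H (t', s)) = c := by
    intro s t
    obtain ⟨c, hc⟩ := hφ (t, s)
    refine ⟨c, ?_⟩
    have : Continuous fun t : ℝ => ((t, s) : ℝ × ℝ) := by fun_prop
    exact this.continuousAt.eventually hc
  have h0 := P.period_eq i (φ := fun t => φ (t, 0)) fun t => by simpa [H] using hslice 0 t
  have h1 := P'.period_eq i (φ := fun t => φ (t, 1)) fun t => by simpa [H] using hslice 1 t
  rw [← h0, ← h1]
  let g : ℝ × ℝ → DualClass X := fun y => φ (y.1 + 2 * Real.pi, y.2) - φ y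
  let _ : TopologicalSpace (DualClass X) := ⊥
  have : DiscreteTopology (DualClass X) := ⟨rfl⟩
  have hg : Continuous g := by
    refine continuous_iff_continuousAt.2 fun y => tendsto_nhds_of_eventually_eq ?_
    obtain ⟨c, hc⟩ := hφ y
    obtain ⟨d, hd⟩ := hφ (y.1 + 2 * Real.pi, y.2)
    have hsh : Continuous fun y : ℝ × ℝ => ((y.1 + 2 * Real.pi, y.2) : ℝ × ℝ) := by fun_prop
    have key : ∀ᶠ z in 𝓝 y, g z = d - c := by
      filter_upwards [hc, hsh.continuousAt.eventually hd] with z hz hz'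
      rw [← hz, ← hz', hper, hper]
      simp only [g]
      abel
    filter_upwards [key] with z hz
    rw [hz, key.self_of_nhds]
  have h := PreconnectedSpace.constant inferInstance hg (x := (0, 0)) (y := (0, 1))
  simpa [g] using h

end Homotopy

end LinkProjection

/-! ### Regions and corners -/

section Corners

variable {X : Type*} [TopologicalSpace X] {A : Set X}

/-- The open quadrant that contains `LinkProjection.quadrantPoint s`. -/
def quadrant (s : Bool × Bool) : Set (ℝ × ℝ) :=
  (if s.1 then Ioi 0 else Iio 0) ×ˢ (if s.2 then Ioi 0 else Iio 0)

/-- The quadrant in which a point off the axes lies. -/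
noncomputable def quadrantOf (q : ℝ × ℝ) : Bool × Bool := (decide (0 < q.1), decide (0 < q.2))

theorem isPreconnected_quadrant (s : Bool × Bool) : IsPreconnected (quadrant s) := by
  rcases s with ⟨_ | _, _ | _⟩ <;>
  simp only [quadrant, if_true, Bool.false_eq_true, if_false] <;>
  exact IsPreconnected.prod (by first | exact isPreconnected_Ioi | exact isPreconnected_Iio)
    (by first | exact isPreconnected_Ioi | exact isPreconnected_Iio)

theorem quadrantPoint_mem (s : Bool × Bool) : LinkProjection.quadrantPoint s ∈ quadrant s := by
  rcases s with ⟨_ | _, _ | _⟩ <;> simp [quadrant, LinkProjection.quadrantPoint]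

theorem mem_quadrantOf {q : ℝ × ℝ} (h₁ : q.1 ≠ 0) (h₂ : q.2 ≠ 0) : q ∈ quadrant (quadrantOf q) := by
  rcases lt_or_gt_of_ne h₁ with h₁ | h₁ <;> rcases lt_or_gt_of_ne h₂ with h₂ | h₂ <;>
  simp [quadrant, quadrantOf, h₁, h₂, not_lt.2 h₁.le, not_lt.2 h₂.le]

theorem ne_zero_of_mem_quadrant {q : ℝ × ℝ} {s : Bool × Bool} (h : q ∈ quadrant s) :
    q.1 ≠ 0 ∧ q.2 ≠ 0 := by
  rcases s with ⟨_ | _, _ | _⟩ <;> simp [quadrant] at h <;>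
  constructor <;> intro h' <;> simp [h'] at h

theorem quadrantOf_eq {q : ℝ × ℝ} {s : Bool × Bool} (h : q ∈ quadrant s) : quadrantOf q = s := by
  rcases s with ⟨_ | _, _ | _⟩ <;> simp [quadrant] at h <;> simp [quadrantOf, h, le_of_lt]

theorem isOpen_quadrant (s : Bool × Bool) : IsOpen (quadrant s) := by
  rcases s with ⟨_ | _, _ | _⟩ <;>
  simp only [quadrant, if_true, Bool.false_eq_true, if_false] <;>
  exact IsOpen.prod (by first | exact isOpen_Ioi | exact isOpen_Iio)
    (by first | exact isOpen_Ioi | exact isOpen_Iio)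

/-- Every neighbourhood of the origin meets every quadrant. -/
theorem exists_mem_quadrant (s : Bool × Bool) {p : ℝ × ℝ → Prop} (h : ∀ᶠ q in 𝓝 0, p q) :
    ∃ q ∈ quadrant s, p q := by
  have hc : Continuous fun t : ℝ => t • LinkProjection.quadrantPoint s := by fun_prop
  have h' : ∀ᶠ t : ℝ in 𝓝 0, p (t • LinkProjection.quadrantPoint s) := by
    have := hc.tendsto 0
    rw [zero_smul] at this
    exact this.eventually h
  obtain ⟨t, ht, ht'⟩ := ((h'.filter_mono nhdsWithin_le_nhds).and
    (self_mem_nhdsWithin : ∀ᶠ t in 𝓝[>] (0 : ℝ), t ∈ Ioi 0)).exists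
  have hpos : 0 < t := ht'
  refine ⟨_, ?_, ht⟩
  rcases s with ⟨_ | _, _ | _⟩ <;> simp [quadrant, LinkProjection.quadrantPoint, hpos]

/-- The function `f` is locally constant off `A`. -/
def LocConstOff (A : Set X) (f : X → ZMod 2) : Prop := ∀ p ∉ A, ∀ᶠ y in 𝓝 p, f y = f p

theorem LocConstOff.eq_of_isPreconnected {f : X → ZMod 2} (hf : LocConstOff A f) {C : Set X}
    (hC : IsPreconnected C) (hCA : ∀ x ∈ C, x ∉ A) {x y : X} (hx : x ∈ C) (hy : y ∈ C) :
    f x = f y := by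
  refine hC.constant (f := f) (fun p hp => ?_) hx hy
  exact tendsto_nhds_of_eventually_eq (nhdsWithin_le_nhds (hf p (hCA p hp)))

theorem IsCrossChart.notMem {p : X} {e : ℝ × ℝ → X} (he : IsCrossChart A p e) {s : Bool × Bool}
    {q : ℝ × ℝ} (hq : q ∈ quadrant s) : e q ∉ A := fun h => by
  have : q.1 = 0 ∨ q.2 = 0 := (Set.ext_iff.1 he.2.2 q).1 h
  have h' := ne_zero_of_mem_quadrant hq
  tauto

theorem IsCrossChart.corner_eq {p : X} {e : ℝ × ℝ → X} (he : IsCrossChart A p e) {f : X → ZMod 2}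
    (hf : LocConstOff A f) {s : Bool × Bool} {q : ℝ × ℝ} (hq : q ∈ quadrant s) :
    f (e q) = f (e (LinkProjection.quadrantPoint s)) := by
  refine hf.eq_of_isPreconnected ((isPreconnected_quadrant s).image e
    he.1.continuous.continuousOn) ?_ (mem_image_of_mem e hq)
    (mem_image_of_mem e (quadrantPoint_mem s))
  rintro _ ⟨q, hq, rfl⟩
  exact he.notMem hq

/-- The sum over the four corners does not depend on the coordinate plane. -/
theorem IsCrossChart.sum_corners_eq {p : X} {e e' : ℝ × ℝ → X} (he : IsCrossChart A p e)
    (he' : IsCrossChart A p e') {f : X → ZMod 2} (hf : LocConstOff A f) :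
    ∑ s, f (e (LinkProjection.quadrantPoint s)) = ∑ s, f (e' (LinkProjection.quadrantPoint s)) := by
  have hpre : ∀ᶠ q in 𝓝 0, e' q ∈ range e := by
    refine he'.1.continuous.continuousAt.eventually ?_
    rw [he'.2.1, ← he.2.1]
    exact he.1.isOpen_range.mem_nhds ⟨0, rfl⟩
  obtain ⟨δ, hδ, hb⟩ := Metric.eventually_nhds_iff_ball.1 hpre
  let E := he.1.toOpenPartialHomeomorph e
  have hE : ∀ q, E.symm (e q) = q := fun q => E.left_inv (by simp [E])
  have hax : ∀ q, e q ∈ A ↔ q.1 = 0 ∨ q.2 = 0 := Set.ext_iff.1 he.2.2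
  have hax' : ∀ q, e' q ∈ A ↔ q.1 = 0 ∨ q.2 = 0 := Set.ext_iff.1 he'.2.2
  -- The quadrant of `e` in which a point of the chart `e'` lies. Near the crossing it is constant
  -- on each quadrant of `e'`, and it turns out to permute the four quadrants.
  let lab : ℝ × ℝ → Bool × Bool := fun q => quadrantOf (E.symm (e' q))
  have hconn : ∀ s, IsPreconnected (quadrant s ∩ Metric.ball 0 δ) := by
    intro s
    refine Convex.isPreconnected (Convex.inter ?_ (convex_ball _ _))
    rcases s with ⟨_ | _, _ | _⟩ <;>
    simp only [quadrant, if_true, Bool.false_eq_true, if_false] <;>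
    exact Convex.prod (by first | exact convex_Ioi _ | exact convex_Iio _)
      (by first | exact convex_Ioi _ | exact convex_Iio _)
  have hlab : ∀ s q q', q ∈ quadrant s ∩ Metric.ball 0 δ → q' ∈ quadrant s ∩ Metric.ball 0 δ →
      lab q = lab q' := by
    intro s q q' hq hq'
    refine (hconn s).constant (f := lab) (fun r hr => ?_) hq hq'
    obtain ⟨r', hr'⟩ := hb r hr.2
    have hr0 : r'.1 ≠ 0 ∧ r'.2 ≠ 0 := by
      rw [← not_or, ← hax, hr']
      exact he'.notMem hr.1
    have hcont : ContinuousAt (fun r => E.symm (e' r)) r :=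
      ContinuousAt.comp (f := e') (E.continuousAt_symm (by simp [E, ← hr']))
        he'.1.continuous.continuousAt
    refine tendsto_nhds_of_eventually_eq (nhdsWithin_le_nhds ?_)
    have hmem : quadrant (quadrantOf r') ∈ 𝓝 (E.symm (e' r)) := by
      rw [← hr', hE]
      exact (isOpen_quadrant _).mem_nhds (mem_quadrantOf hr0.1 hr0.2)
    filter_upwards [hcont.preimage_mem_nhds hmem] with r'' h''
    simp only [lab]
    rw [quadrantOf_eq h'', ← hr', hE]
  choose ρ hρ hρ' using fun s => exists_mem_quadrant s (Metric.ball_mem_nhds (0 : ℝ × ℝ) hδ)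
  have hval : ∀ s, f (e' (LinkProjection.quadrantPoint s)) =
      f (e (LinkProjection.quadrantPoint (lab (ρ s)))) := by
    intro s
    rw [← he'.corner_eq hf (hρ s)]
    obtain ⟨r, hr⟩ := hb _ (hρ' s)
    have hr0 : r.1 ≠ 0 ∧ r.2 ≠ 0 := by
      rw [← not_or, ← hax, hr]
      exact he'.notMem (hρ s)
    rw [← hr, he.corner_eq hf (mem_quadrantOf hr0.1 hr0.2)]
    simp only [lab]
    rw [← hr, hE]
  -- Every quadrant of `e` reaches into the small ball of `e'`; a surjection of four labels onto
  -- four is a bijection.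
  have hsurj : Function.Surjective fun s => lab (ρ s) := by
    intro s
    have hev : ∀ᶠ q in 𝓝 0, e q ∈ e' '' Metric.ball 0 δ := by
      refine he.1.continuous.continuousAt.eventually ?_
      rw [he.2.1, ← he'.2.1]
      exact he'.1.image_mem_nhds.2 (Metric.ball_mem_nhds _ hδ)
    obtain ⟨q, hq, q', hq', hqq⟩ := exists_mem_quadrant s hev
    have h0 : q'.1 ≠ 0 ∧ q'.2 ≠ 0 := by
      rw [← not_or, ← hax', hqq]
      exact he.notMem hq
    refine ⟨quadrantOf q', ?_⟩
    simp only
    rw [hlab _ _ q' ⟨hρ _, hρ' _⟩ ⟨mem_quadrantOf h0.1 h0.2, hq'⟩]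
    simp only [lab]
    rw [hqq, hE, quadrantOf_eq hq]
  have hbij : Function.Bijective fun s => lab (ρ s) :=
    ⟨Finite.injective_iff_surjective.2 hsurj, hsurj⟩
  simp only [hval]
  exact (hbij.sum_comp fun s => f (e (LinkProjection.quadrantPoint s))).symm

/-- The functions on the complement of `A`, extended by zero, that are constant on the regions and
sum up to zero around the points of `S`. -/
def evenSpace (A S : Set X) : Submodule (ZMod 2) (X → ZMod 2) where
  carrier := {f | (∀ p ∈ A, f p = 0) ∧ LocConstOff A f ∧ ∀ c ∈ S, ∀ e, IsCrossChart A c e →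
    ∑ s, f (e (LinkProjection.quadrantPoint s)) = 0}
  zero_mem' := ⟨fun _ _ => rfl, fun _ _ => .of_forall fun _ => rfl, fun _ _ _ _ => by simp⟩
  add_mem' := by
    rintro f g ⟨hf, hf', hf''⟩ ⟨hg, hg', hg''⟩
    refine ⟨fun p hp => by simp [hf p hp, hg p hp], fun p hp => ?_, fun c hc e he => ?_⟩
    · filter_upwards [hf' p hp, hg' p hp] with y h h'
      simp [h, h']
    · simp [Finset.sum_add_distrib, hf'' c hc e he, hg'' c hc e he]
  smul_mem' := by
    rintro k f ⟨hf, hf', hf''⟩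
    refine ⟨fun p hp => by simp [hf p hp], fun p hp => ?_, fun c hc e he => ?_⟩
    · filter_upwards [hf' p hp] with y h
      simp [h]
    · simp [← Finset.mul_sum, hf'' c hc e he]

end Corners

/-! ### Finiteness of the regions and the kernel of the transposed matrix -/

namespace LinkProjection

variable {n : ℕ} {X : Type*} [TopologicalSpace X] (P : LinkProjection n X)

theorem mk_eq_mk_of_isPreconnected {C : Set X} (hC : IsPreconnected C)
    (hCA : C ⊆ (range P.curve)ᶜ) {x y : {x : X // x ∉ range P.curve}} (hx : x.1 ∈ C)
    (hy : y.1 ∈ C) : (ConnectedComponents.mk x : P.Region) = ConnectedComponents.mk y := by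
  have h : IsPreconnected ((↑) ⁻¹' C : Set {x : X // x ∉ range P.curve}) := by
    refine (IsEmbedding.subtypeVal (p := fun x => x ∉ range
      P.curve)).isInducing.isPreconnected_image.1 ?_
    rwa [image_preimage_eq_of_subset fun x hx => ⟨⟨x, hCA hx⟩, rfl⟩]
  refine (ConnectedComponents.coe_eq_coe'.2 ?_)
  exact h.subset_connectedComponent hy hx

theorem finite_region_of_cover {U : Set X} {ι : Type*} [Finite ι] (C : ι → Set X)
    (hC : ∀ k, IsPreconnected (C k)) (hCA : ∀ k, C k ⊆ (range P.curve)ᶜ)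
    (hU : ∀ x ∈ U, x ∉ range P.curve → ∃ k, x ∈ C k) :
    {R : P.Region | ∃ x : {x : X // x ∉ range P.curve}, x.1 ∈ U ∧
      ConnectedComponents.mk x = R}.Finite := by
  refine (finite_iUnion (f := fun k => {R : P.Region | ∃ x : {x : X // x ∉ range P.curve},
    x.1 ∈ C k ∧ ConnectedComponents.mk x = R}) fun k => Set.Subsingleton.finite ?_).subset ?_
  · rintro _ ⟨x, hx, rfl⟩ _ ⟨y, hy, rfl⟩
    exact P.mk_eq_mk_of_isPreconnected (hC k) (hCA k) hx hy
  · rintro _ ⟨x, hx, rfl⟩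
    obtain ⟨k, hk⟩ := hU x.1 hx x.2
    exact mem_iUnion.2 ⟨k, x, hk, rfl⟩

theorem isClosed_range [T2Space X] : IsClosed (range P.curve) :=
  (isCompact_range P.curve.continuous).isClosed

open Classical in
/-- Extension by zero of a function on the regions. -/
noncomputable def regionExtend : (P.Region → ZMod 2) →ₗ[ZMod 2] (X → ZMod 2) where
  toFun x p := if h : p ∉ range P.curve then x (ConnectedComponents.mk ⟨p, h⟩) else 0
  map_add' x y := by
    funext p
    by_cases h : p ∈ range P.curve
    · simp only [Pi.add_apply, dif_neg (not_not.2 h), add_zero]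
    · simp only [Pi.add_apply, dif_pos h]
      rfl
  map_smul' c x := by
    funext p
    by_cases h : p ∈ range P.curve
    · simp only [Pi.smul_apply, dif_neg (not_not.2 h), smul_zero]
    · simp only [Pi.smul_apply, dif_pos h]
      rfl

theorem regionExtend_of_notMem (x : P.Region → ZMod 2) {p : X} (h : p ∉ range P.curve) :
    P.regionExtend x p = x (ConnectedComponents.mk ⟨p, h⟩) :=
  dif_pos h

theorem regionExtend_injective : Function.Injective P.regionExtend := by
  intro x y h
  funext R
  obtain ⟨p, rfl⟩ := ConnectedComponents.surjective_coe R
  have := congrFun h p.1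
  rwa [regionExtend_of_notMem _ _ p.2, regionExtend_of_notMem _ _ p.2] at this

theorem transpose_mulVec [Fintype P.Region] (x : P.Region → ZMod 2) (c : P.Crossing) :
    P.incidenceMatrix.transpose.mulVec x c = ∑ s, x (P.cornerRegion c s) := by
  classical
  have h : ∀ R, (Nat.card {s : Bool × Bool // P.cornerRegion c s = R} : ZMod 2) =
      ∑ s, if P.cornerRegion c s = R then 1 else 0 := by
    intro R
    rw [Nat.card_eq_fintype_card, Fintype.card_subtype, Finset.sum_boole]
  simp only [Matrix.mulVec, dotProduct, Matrix.transpose_apply, incidenceMatrix, h, Finset.sum_mul,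
    ite_mul, one_mul, zero_mul]
  rw [Finset.sum_comm]
  simp

variable [T2Space X] [ChartedSpace (EuclideanSpace ℝ (Fin 2)) X]

/-- Every point has a neighbourhood that meets at most four regions: four quadrants at a crossing,
two half planes at a regular point, one plane off the projection. Compactness does the rest. -/
theorem finite_region [CompactSpace X] : Finite P.Region := by
  have hloc : ∀ x : X, ∃ U ∈ 𝓝 x, {R : P.Region | ∃ y : {x : X // x ∉ range P.curve},
      y.1 ∈ U ∧ ConnectedComponents.mk y = R}.Finite := by
    intro x
    by_cases hx : x ∈ range P.curve
    · obtain ⟨z, rfl⟩ := hx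
      by_cases hz : P.IsDouble z
      · obtain ⟨e, he⟩ := P.exists_crossChart ⟨_, hz.mem_crossings⟩
        refine ⟨range e, he.1.isOpen_range.mem_nhds ⟨0, he.2.1⟩,
          P.finite_region_of_cover (fun s => e '' quadrant s)
          (fun s => (isPreconnected_quadrant s).image e he.1.continuous.continuousOn) ?_ ?_⟩
        · rintro s _ ⟨q, hq, rfl⟩
          exact he.notMem hq
        · rintro _ ⟨q, rfl⟩ hq
          have : ¬ (q.1 = 0 ∨ q.2 = 0) := fun h => hq ((Set.ext_iff.1 he.2.2 q).2 h)
          rw [not_or] at this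
          exact ⟨_, mem_image_of_mem e (mem_quadrantOf this.1 this.2)⟩
      · obtain ⟨e, he⟩ := exists_arcChart hz
        refine ⟨range e, he.1.isOpen_range.mem_nhds ⟨0, he.2.1⟩, P.finite_region_of_cover
          (fun b : Bool => e '' (univ ×ˢ if b then Ioi 0 else Iio 0)) (fun b => ?_) ?_ ?_⟩
        · refine IsPreconnected.image (isPreconnected_univ.prod ?_) e he.1.continuous.continuousOn
          cases b
          · exact isPreconnected_Iio
          · exact isPreconnected_Ioi
        · rintro b _ ⟨q, ⟨-, hq⟩, rfl⟩ h
          have h0 : q.2 = 0 := (Set.ext_iff.1 he.2.2 q).1 h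
          cases b <;> simp [h0] at hq
        · rintro _ ⟨q, rfl⟩ hq
          have : q.2 ≠ 0 := fun h => hq ((Set.ext_iff.1 he.2.2 q).2 h)
          rcases lt_or_gt_of_ne this with h | h
          · exact ⟨false, q, ⟨trivial, h⟩, rfl⟩
          · exact ⟨true, q, ⟨trivial, h⟩, rfl⟩
    · obtain ⟨e, he, he0, hr⟩ := exists_plane (P.isClosed_range.isOpen_compl.mem_nhds hx)
      refine ⟨range e, he.isOpen_range.mem_nhds ⟨0, he0⟩, P.finite_region_of_cover
        (fun _ : Unit => range e) (fun _ => isPreconnected_range he.continuous) (fun _ => hr)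
        fun y hy _ => ⟨(), hy⟩⟩
  choose U hU hfin using hloc
  obtain ⟨t, ht⟩ := CompactSpace.elim_nhds_subcover U hU
  refine Set.finite_univ_iff.1 ((t.finite_toSet.biUnion fun x _ => hfin x).subset ?_)
  intro R _
  obtain ⟨y, rfl⟩ := ConnectedComponents.surjective_coe R
  have : y.1 ∈ ⋃ x ∈ t, U x := ht ▸ mem_univ _
  obtain ⟨x, hx, hy⟩ := mem_iUnion₂.1 this
  exact mem_iUnion₂.2 ⟨x, hx, y, hy, rfl⟩

theorem locConstOff_regionExtend (x : P.Region → ZMod 2) :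
    LocConstOff (range P.curve) (P.regionExtend x) := by
  intro p hp
  obtain ⟨e, he, he0, hr⟩ := exists_plane (P.isClosed_range.isOpen_compl.mem_nhds hp)
  filter_upwards [he.isOpen_range.mem_nhds ⟨0, he0⟩] with y hy
  rw [regionExtend_of_notMem _ _ hp, regionExtend_of_notMem _ _ (hr hy)]
  exact congrArg x (P.mk_eq_mk_of_isPreconnected (isPreconnected_range he.continuous) hr hy
    ⟨0, he0⟩)

theorem map_regionExtend_ker [Fintype P.Region] :
    (LinearMap.ker P.incidenceMatrix.transpose.mulVecLin).map P.regionExtend =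
      evenSpace (range P.curve) P.crossings := by
  have hcorner : ∀ x c, ∑ s, P.regionExtend x (P.crossChart c (quadrantPoint s)) =
      ∑ s, x (P.cornerRegion c s) := fun x c => Finset.sum_congr rfl fun s _ =>
    P.regionExtend_of_notMem x (P.crossChart_quadrantPoint_notMem c s)
  ext f
  constructor
  · rintro ⟨x, hx, rfl⟩
    refine ⟨fun p hp => dif_neg (not_not.2 hp), P.locConstOff_regionExtend x, fun c hc e he => ?_⟩
    refine (he.sum_corners_eq (P.crossChart_spec ⟨c, hc⟩) (P.locConstOff_regionExtend x)).trans ?_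
    refine (hcorner x ⟨c, hc⟩).trans ((P.transpose_mulVec x ⟨c, hc⟩).symm.trans ?_)
    exact congrFun hx _
  · rintro ⟨h0, hf, hs⟩
    have hc : Continuous fun p : {x : X // x ∉ range P.curve} => f p.1 := by
      refine continuous_iff_continuousAt.2 fun p => tendsto_nhds_of_eventually_eq ?_
      exact continuous_subtype_val.continuousAt.eventually (hf p.1 p.2)
    let x : P.Region → ZMod 2 := hc.connectedComponentsLift
    have hx : P.regionExtend x = f := by
      funext p
      by_cases hp : p ∈ range P.curve
      · rw [h0 p hp]
        exact dif_neg (not_not.2 hp)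
      · rw [regionExtend_of_notMem _ _ hp]
        exact hc.connectedComponentsLift_apply_coe ⟨p, hp⟩
    refine ⟨x, ?_, hx⟩
    refine funext fun c => ?_
    rw [Matrix.mulVecLin_apply, P.transpose_mulVec, ← hcorner, hx]
    exact hs c.1 c.2 _ (P.crossChart_spec c)

theorem finite_evenSpace [CompactSpace X] :
    Module.Finite (ZMod 2) (evenSpace (range P.curve) P.crossings) := by
  have := P.finite_region
  have := Fintype.ofFinite P.Region
  rw [← P.map_regionExtend_ker]
  infer_instance

/-- Rank-nullity for the transpose, whose kernel is the even space and whose rank is that of the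
matrix. -/
theorem regionDefect_eq [CompactSpace X] : P.regionDefect =
    Module.finrank (ZMod 2) (evenSpace (range P.curve) P.crossings) := by
  have := P.finite_region
  have := Fintype.ofFinite P.Region
  have hfin : Module.finrank (ZMod 2) (evenSpace (range P.curve) P.crossings) =
      Module.finrank (ZMod 2) (LinearMap.ker P.incidenceMatrix.transpose.mulVecLin) := by
    rw [← P.map_regionExtend_ker]
    exact (Submodule.equivMapOfInjective _ P.regionExtend_injective _).finrank_eq.symm
  have h := LinearMap.finrank_range_add_finrank_ker P.incidenceMatrix.transpose.mulVecLin
  rw [Module.finrank_fintype_fun_eq_card] at h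
  rw [hfin, regionDefect, ← Matrix.rank_transpose, Nat.card_eq_fintype_card, ← h, Matrix.rank]
  push_cast
  ring

end LinkProjection

/-! ### Jumps along the components -/

section Cross

variable {X : Type*} [TopologicalSpace X]

theorem EvConst.sub_smul_congr {x : X} {f u v : X → ZMod 2} {j : ZMod 2}
    (h : EvConst (denseInterior X) x (f - j • u)) (huv : EvConst (denseInterior X) x (u - v)) :
    EvConst (denseInterior X) x (f - j • v) := by
  obtain ⟨c, hc⟩ := h
  obtain ⟨d, hd⟩ := huv
  refine ⟨c + j * d, ?_⟩
  filter_upwards [hc, hd] with y h h'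
  simp only [Pi.sub_apply, Pi.smul_apply, smul_eq_mul] at *
  rw [← h, ← h']
  ring

theorem LocConstOff.evConst {A : Set X} {f : X → ZMod 2} (hf : LocConstOff A f) {p : X}
    (hp : p ∉ A) : EvConst (denseInterior X) p f :=
  ⟨f p, (hf p hp).filter_mono inf_le_left⟩

theorem IsCrossChart.eventually_axis {A : Set X} {p : X} {e : ℝ × ℝ → X} (he : IsCrossChart A p e)
    {t : ℝ} (ht : t ≠ 0) : ∀ᶠ q in 𝓝 ((t, 0) : ℝ × ℝ), e q ∈ A ↔ q.2 = 0 := by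
  filter_upwards [(isOpen_ne_fun continuous_fst continuous_const).mem_nhds ht] with q hq
  have : e q ∈ A ↔ q.1 = 0 ∨ q.2 = 0 := Set.ext_iff.1 he.2.2 q
  rw [this]
  exact or_iff_right hq

/-- The jump across the horizontal axis of a cross. -/
theorem IsCrossChart.jump_eq_corners {A : Set X} {p : X} {e : ℝ × ℝ → X}
    (he : IsCrossChart A p e) {f : X → ZMod 2} (hf : LocConstOff A f) {t : ℝ} (ht : t ≠ 0)
    {j : ZMod 2} (hj : EvConst (denseInterior X) (e (t, 0)) (f - j • upperSide e)) :
    f (e (LinkProjection.quadrantPoint (decide (0 < t), true))) -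
      f (e (LinkProjection.quadrantPoint (decide (0 < t), false))) = j := by
  have hsign : ∀ᶠ q : ℝ × ℝ in 𝓝 (t, 0),
      q.1 ∈ (if decide (0 < t) then Ioi 0 else Iio 0 : Set ℝ) := by
    refine continuous_fst.continuousAt.eventually ?_
    rcases lt_or_gt_of_ne ht with h | h
    · simpa [not_lt.2 h.le] using eventually_lt_nhds h
    · simpa [h] using eventually_gt_nhds h
  refine jump_eq he.1 rfl hj ?_ ?_
  · filter_upwards [hsign] with q hq hq'
    have hmem : q ∈ quadrant (decide (0 < t), true) := ⟨hq, by simpa using hq'⟩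
    rw [← he.corner_eq hf hmem]
    exact (hf _ (he.notMem hmem)).filter_mono inf_le_left
  · filter_upwards [hsign] with q hq hq'
    have hmem : q ∈ quadrant (decide (0 < t), false) := ⟨hq, by simpa using hq'⟩
    rw [← he.corner_eq hf hmem]
    exact (hf _ (he.notMem hmem)).filter_mono inf_le_left

end Cross

/-! ### Even functions and their jumps -/

namespace LinkProjection

section JumpSpace

variable {n : ℕ} {X : Type*} [TopologicalSpace X] {P : LinkProjection n X}

theorem jump_unique {z : Circles n} (hz : ¬ P.IsDouble z) {f : X → ZMod 2} {j k : ZMod 2}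
    (hj : EvConst (denseInterior X) (P.curve z) (f - j • P.side (P.curve z)))
    (hk : EvConst (denseInterior X) (P.curve z) (f - k • P.side (P.curve z))) : j = k := by
  obtain ⟨e, he, hs⟩ := exists_side_eq hz
  rw [hs, ← he.2.1] at hj hk
  by_contra hjk
  have h1 : k - j = 1 := by
    clear hj hk
    revert j k
    decide
  refine not_evConst_upperSide he.1 (w := 0) rfl ?_
  have := hj.sub hk
  rwa [sub_sub_sub_cancel_left, ← sub_smul, h1, one_smul] at this

theorem neBot_punctured (z : Circles n) : (𝓝[≠] z).NeBot := by
  obtain ⟨i, ζ⟩ := z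
  obtain ⟨t, rfl⟩ := Circle.exp_surjective ζ
  have h : Tendsto (circleParam i) (𝓝[≠] t) (𝓝[≠] (circleParam i t)) := by
    refine tendsto_nhdsWithin_iff.2 ⟨(continuous_circleParam i).continuousAt.tendsto.mono_left
      nhdsWithin_le_nhds, ?_⟩
    filter_upwards [self_mem_nhdsWithin,
      nhdsWithin_le_nhds (Metric.ball_mem_nhds t Real.two_pi_pos)] with s hs hs' h
    exact hs (circleParam_injOn i hs' h)
  exact h.neBot

theorem exists_not_isDouble (z : Circles n) {p : Circles n → Prop} (h : ∀ᶠ v in 𝓝 z, p v) :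
    ∃ v, ¬ P.IsDouble v ∧ p v := by
  have := neBot_punctured z
  exact ((eventually_not_isDouble z).and (h.filter_mono nhdsWithin_le_nhds)).exists

theorem exists_regular_of_component (i : Fin n) : ∃ ζ, ¬ P.IsDouble (i, ζ) := by
  have hopen : ∀ᶠ v : Circles n in 𝓝 (i, 1), v.1 = i :=
    continuous_fst.continuousAt.eventually ((isOpen_discrete {i}).mem_nhds (mem_singleton i))
  obtain ⟨⟨k, ζ⟩, hv, rfl⟩ := P.exists_not_isDouble (i, 1) hopen
  exact ⟨ζ, hv⟩

variable (P) in
/-- Pairs of a function that is constant on the regions and its jumps across the components. -/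
def jumpSpace : Submodule (ZMod 2) ((X → ZMod 2) × (Fin n → ZMod 2)) where
  carrier := {g | (∀ p ∈ range P.curve, g.1 p = 0) ∧ LocConstOff (range P.curve) g.1 ∧
    ∀ z, ¬ P.IsDouble z → EvConst (denseInterior X) (P.curve z)
      (g.1 - g.2 z.1 • P.side (P.curve z))}
  zero_mem' := ⟨fun _ _ => rfl, fun _ _ => .of_forall fun _ => rfl, fun _ _ => by
    simpa using EvConst.zero⟩
  add_mem' := by
    rintro f g ⟨hf, hf', hf''⟩ ⟨hg, hg', hg''⟩
    refine ⟨fun p hp => by simp [hf p hp, hg p hp], fun p hp => ?_, fun z hz => ?_⟩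
    · filter_upwards [hf' p hp, hg' p hp] with y h h'
      simp [h, h']
    · have := (hf'' z hz).add (hg'' z hz)
      rwa [sub_add_sub_comm, ← add_smul] at this
  smul_mem' := by
    rintro k f ⟨hf, hf', hf''⟩
    refine ⟨fun p hp => by simp [hf p hp], fun p hp => ?_, fun z hz => ?_⟩
    · filter_upwards [hf' p hp] with y h
      simp [h]
    · obtain ⟨c, hc⟩ := hf'' z hz
      refine ⟨k * c, ?_⟩
      filter_upwards [hc] with y hy
      rw [← hy]
      simp [mul_sub, mul_assoc]

/-- Every component has a regular point, where the function determines its jump. -/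
theorem jumpSpace_fst_injOn :
    InjOn Prod.fst (P.jumpSpace : Set ((X → ZMod 2) × (Fin n → ZMod 2))) := by
  rintro ⟨f, j⟩ hf ⟨g, k⟩ hg rfl
  refine Prod.ext rfl (funext fun i => ?_)
  obtain ⟨ζ, hζ⟩ := P.exists_regular_of_component i
  exact jump_unique hζ (hf.2.2 _ hζ) (hg.2.2 _ hζ)

variable (P) in
/-- The class dual to a linear combination of the components. -/
noncomputable def classMap : (Fin n → ZMod 2) →ₗ[ZMod 2] DualClass X :=
  Fintype.linearCombination (ZMod 2) fun i => (nullClasses X).mkQ (P.componentPotential i)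

theorem sum_componentPotential_of_notMem (j : Fin n → ZMod 2) {p : X} (hp : p ∉ range P.curve) :
    (∑ i, j i • P.componentPotential i) p = 0 := by
  simp only [Finset.sum_apply, Pi.smul_apply]
  refine Finset.sum_eq_zero fun i _ => ?_
  rw [componentPotential, if_neg, smul_zero]
  rintro ⟨ζ, h, -⟩
  exact hp ⟨_, h⟩

theorem sum_componentPotential (j : Fin n → ZMod 2) {z : Circles n} (hz : ¬ P.IsDouble z) :
    (∑ i, j i • P.componentPotential i) (P.curve z) = j z.1 • P.side (P.curve z) := by
  simp only [Finset.sum_apply, Pi.smul_apply]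
  rw [Finset.sum_eq_single z.1]
  · rw [componentPotential, if_pos ⟨z.2, rfl, hz⟩]
  · intro i _ hi
    rw [componentPotential, if_neg, smul_zero]
    rintro ⟨ζ, h, -⟩
    exact hz ⟨(i, ζ), fun h' => hi (congrArg Prod.fst h'), h⟩
  · simp

theorem mem_ker_classMap {j : Fin n → ZMod 2} : j ∈ LinearMap.ker P.classMap ↔
    (∑ i, j i • P.componentPotential i) ∈ nullClasses X := by
  rw [LinearMap.mem_ker, classMap, Fintype.linearCombination_apply]
  simp only [← map_smul, ← map_sum]
  rw [Submodule.mkQ_apply, Submodule.Quotient.mk_eq_zero]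

/-- Mod 2, evenness at a crossing means that the jump across the horizontal axis is the same on the
right and on the left; this lets jumps pass through crossings. -/
theorem sum_corners_eq_zero_iff (g : Bool × Bool → ZMod 2) :
    ∑ s, g s = 0 ↔ g (true, true) - g (true, false) = g (false, true) - g (false, false) := by
  rw [Fintype.sum_prod_type]
  simp only [Fintype.sum_bool]
  generalize g (true, true) = a
  generalize g (true, false) = b
  generalize g (false, true) = c
  generalize g (false, false) = d
  revert a b c d
  decide

/-- The jump of an even function is locally constant along the projection. -/
theorem exists_local_jump {f : X → ZMod 2} (hf : f ∈ evenSpace (range P.curve) P.crossings)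
    (z : Circles n) : ∃ j : ZMod 2, ∀ᶠ v in 𝓝 z, ¬ P.IsDouble v →
      EvConst (denseInterior X) (P.curve v) (f - j • P.side (P.curve v)) := by
  by_cases hz : P.IsDouble z
  · obtain ⟨w, hw, hwz⟩ := hz
    obtain ⟨e, he, hez, hew⟩ := P.transverse z w hw.symm hwz.symm
    have heven := (sum_corners_eq_zero_iff fun s => f (e (quadrantPoint s))).1
      (hf.2.2 _ ⟨z, w, hw.symm, rfl, hwz⟩ e he)
    refine ⟨f (e (quadrantPoint (true, true))) - f (e (quadrantPoint (true, false))), ?_⟩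
    filter_upwards [hez] with v hv hd
    obtain ⟨q, hq, hqv⟩ := hv
    have hq2 : q.2 = 0 := hq
    have ht : q.1 ≠ 0 := by
      intro h
      refine hd (isDouble_iff.2 ?_)
      rw [← hqv, show q = 0 from Prod.ext h hq2, he.2.1]
      exact ⟨z, w, hw.symm, rfl, hwz⟩
    obtain ⟨t, u⟩ := q
    obtain rfl : u = 0 := hq2
    obtain ⟨j, hj⟩ := exists_jump he.1 (w := (t, 0)) rfl (f := f) (by
      filter_upwards [IsCrossChart.eventually_axis he ht] with q hq hq0
      exact LocConstOff.evConst hf.2.1 fun h => hq0 (hq.1 h))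
    have hcorn := IsCrossChart.jump_eq_corners he hf.2.1 ht hj
    have hj' : f (e (quadrantPoint (true, true))) - f (e (quadrantPoint (true, false))) = j := by
      rcases lt_or_gt_of_ne ht with h | h
      · simp only [not_lt.2 h.le, decide_false] at hcorn
        exact heven.trans hcorn
      · simpa only [show 0 < t from h, decide_true] using hcorn
    rw [hj']
    have hs := side_compat hd he.1 hqv rfl (IsCrossChart.eventually_axis he ht)
    rw [hqv] at hj
    exact EvConst.sub_smul_congr hj hs.sub_comm
  · obtain ⟨e, he⟩ := exists_arcChart hz
    have hax : ∀ q, e q ∈ range P.curve ↔ q.2 = 0 := Set.ext_iff.1 he.2.2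
    obtain ⟨j, hj⟩ := exists_jump he.1 (w := 0) rfl (f := f)
      (.of_forall fun q hq => LocConstOff.evConst hf.2.1 fun h => hq ((hax q).1 h))
    rw [he.2.1] at hj
    refine ⟨j, ?_⟩
    filter_upwards [P.curve.continuous.continuousAt.eventually hj.eventually,
      P.curve.continuous.continuousAt.preimage_mem_nhds
        (he.1.isOpen_range.mem_nhds ⟨0, he.2.1⟩)] with v hv hv' hd
    obtain ⟨q, hq⟩ := hv'
    exact EvConst.sub_smul_congr hv (side_compat hd he.1 hq ((hax q).1 ⟨v, hq.symm⟩)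
      (.of_forall hax)).sub_comm

/-- The local jumps at neighbouring parameters agree at a common regular parameter, so they are
locally constant; each circle is connected. -/
theorem exists_mem_jumpSpace {f : X → ZMod 2} (hf : f ∈ evenSpace (range P.curve) P.crossings) :
    ∃ j, (f, j) ∈ P.jumpSpace := by
  choose g hg using P.exists_local_jump hf
  have hcont : Continuous g := by
    refine continuous_iff_continuousAt.2 fun z => tendsto_nhds_of_eventually_eq ?_
    filter_upwards [eventually_eventually_nhds.2 (hg z)] with v hv
    obtain ⟨w, hw, h₁, h₂⟩ := P.exists_not_isDouble v (hv.and (hg v))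
    exact jump_unique hw (h₂ hw) (h₁ hw)
  refine ⟨fun i => g (i, 1), hf.1, hf.2.1, ?_⟩
  rintro ⟨i, ζ⟩ hz
  obtain ⟨t, rfl⟩ := Circle.exp_surjective ζ
  have hc : Continuous fun t => g (circleParam i t) := hcont.comp (continuous_circleParam i)
  have h := PreconnectedSpace.constant inferInstance hc (x := t) (y := 0)
  simp only [circleParam, Circle.exp_zero] at h
  simp only [← h]
  exact (hg _).self_of_nhds hz

variable [T2Space X]

/-- By compactness of the circles, the parameters outside `N` have a closed image, and it misses
`p`. -/
theorem eventually_fiber {p : X} {N : Set (Circles n)} (hN : ∀ z, P.curve z = p → N ∈ 𝓝 z) :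
    ∀ᶠ x in 𝓝 p, ∀ z, P.curve z = x → z ∈ N := by
  have hcl : IsClosed (P.curve '' (interior N)ᶜ) :=
    (isOpen_interior.isClosed_compl.isCompact.image P.curve.continuous).isClosed
  have hp : p ∉ P.curve '' (interior N)ᶜ := by
    rintro ⟨z, hz, h⟩
    exact hz (mem_interior_iff_mem_nhds.2 (hN z h))
  filter_upwards [hcl.isOpen_compl.mem_nhds hp] with x hx z hz
  by_contra h
  exact hx ⟨z, fun hzN => h (interior_subset hzN), hz⟩

/-- Near a crossing, the points of the horizontal axis belong to the horizontal strand. -/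
theorem eventually_strand {z w : Circles n} (hzw : z ≠ w) (hc : P.curve z = P.curve w)
    {e : ℝ × ℝ → X} (he : IsCrossChart (range P.curve) (P.curve z) e)
    (hw : ∀ᶠ v in 𝓝 w, P.curve v ∈ e '' {q | q.1 = 0}) :
    ∀ᶠ t : ℝ in 𝓝[≠] 0, ∃ v, v.1 = z.1 ∧ ¬ P.IsDouble v ∧ P.curve v = e (t, 0) := by
  -- Parameters near `z` stay on its component, and those near `w` land on the vertical axis. A
  -- point of the horizontal axis other than the origin is therefore hit only by the first kind.
  have hN : ∀ v, P.curve v = P.curve z →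
      {v | v.1 = z.1 ∨ P.curve v ∈ e '' {q | q.1 = 0}} ∈ 𝓝 v := by
    intro v hv
    rcases P.double z w v hc (hc.symm.trans hv.symm) with h | rfl | rfl
    · exact (hzw h).elim
    · exact hw.mono fun _ h => .inr h
    · have : ∀ᶠ v : Circles n in 𝓝 z, v.1 = z.1 :=
        continuous_fst.continuousAt.eventually ((isOpen_discrete {z.1}).mem_nhds rfl)
      exact this.mono fun _ h => .inl h
  have h₁ := eventually_fiber hN
  rw [← he.2.1] at h₁
  have h₂ := Set.Finite.eventually_punctured_notMem P.finite_double (e 0)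
  rw [eventually_nhdsWithin_iff] at h₂
  have hcont : Continuous fun t : ℝ => e (t, 0) := he.1.continuous.comp (by fun_prop)
  rw [eventually_nhdsWithin_iff]
  filter_upwards [hcont.continuousAt.eventually h₁, hcont.continuousAt.eventually h₂]
    with t ht₁ ht₂ ht
  have ht0 : t ≠ 0 := ht
  obtain ⟨v, hv⟩ : e (t, 0) ∈ range P.curve := (Set.ext_iff.1 he.2.2 (t, 0)).2 (.inr rfl)
  refine ⟨v, (ht₁ v hv).resolve_right ?_, fun hd => ?_, hv⟩
  · rintro ⟨q, hq, h⟩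
    have := he.1.injective (h.trans hv)
    exact ht0 ((congrArg Prod.fst this).symm.trans hq)
  · refine ht₂ (fun h => ht0 (congrArg Prod.fst (he.1.injective h))) ?_
    rw [← hv]
    exact hd.mem_crossings

theorem mem_evenSpace_of_jumpSpace {g : (X → ZMod 2) × (Fin n → ZMod 2)} (hg : g ∈ P.jumpSpace) :
    g.1 ∈ evenSpace (range P.curve) P.crossings := by
  refine ⟨hg.1, hg.2.1, ?_⟩
  rintro c ⟨z, w, hzw, hz, hw⟩ e' he'
  obtain ⟨e, he, hez, hew⟩ := P.transverse z w hzw (hz.trans hw.symm)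
  rw [← hz] at he'
  rw [he'.sum_corners_eq he hg.2.1, sum_corners_eq_zero_iff]
  have hstrand := eventually_strand hzw (hz.trans hw.symm) he hew
  have key : ∀ t : ℝ, t ≠ 0 → (∃ v, v.1 = z.1 ∧ ¬ P.IsDouble v ∧ P.curve v = e (t, 0)) →
      g.1 (e (quadrantPoint (decide (0 < t), true))) -
        g.1 (e (quadrantPoint (decide (0 < t), false))) = g.2 z.1 := by
    rintro t ht ⟨v, hv, hd, hvt⟩
    refine IsCrossChart.jump_eq_corners he hg.2.1 ht ?_
    have h := EvConst.sub_smul_congr (hg.2.2 v hd)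
      (side_compat hd he.1 hvt.symm rfl (IsCrossChart.eventually_axis he ht))
    rwa [hvt, hv] at h
  -- One regular point on each half of the horizontal axis; both lie on the component of `z`, so
  -- both jumps are `g.2 z.1`.
  obtain ⟨t, ht, ht'⟩ := ((hstrand.filter_mono (nhdsWithin_mono _ fun t (ht : t ∈ Ioi 0) =>
    ne_of_gt ht)).and self_mem_nhdsWithin).exists
  obtain ⟨s, hs, hs'⟩ := ((hstrand.filter_mono (nhdsWithin_mono _ fun t (ht : t ∈ Iio 0) =>
    ne_of_lt ht)).and self_mem_nhdsWithin).exists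
  have ht0 : 0 < t := ht'
  have hs0 : s < 0 := hs'
  have h₁ := key t ht0.ne' ht
  have h₂ := key s hs0.ne hs
  simp only [ht0, decide_true] at h₁
  simp only [not_lt.2 hs0.le, decide_false] at h₂
  exact h₁.trans h₂.symm

theorem map_fst_jumpSpace :
    P.jumpSpace.map (LinearMap.fst _ _ _) = evenSpace (range P.curve) P.crossings := by
  ext f
  constructor
  · rintro ⟨g, hg, rfl⟩
    exact mem_evenSpace_of_jumpSpace hg
  · intro hf
    obtain ⟨j, hj⟩ := exists_mem_jumpSpace hf
    exact ⟨_, hj, rfl⟩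

variable (P) in
/-- The jump space and the even space are isomorphic. -/
noncomputable def jumpSpaceEquiv :
    P.jumpSpace ≃ₗ[ZMod 2] evenSpace (range P.curve) P.crossings :=
  (LinearEquiv.ofInjective ((LinearMap.fst _ _ _).domRestrict P.jumpSpace) (by
    intro x y h
    exact Subtype.ext (jumpSpace_fst_injOn x.2 y.2 h))).trans
    (LinearEquiv.ofEq _ _ (by rw [LinearMap.range_domRestrict, map_fst_jumpSpace]))

theorem compl_range_mem_denseInterior : (range P.curve)ᶜ ∈ denseInterior X := by
  rw [mem_denseInterior, P.isClosed_range.isOpen_compl.interior_eq]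
  intro x
  by_cases hx : x ∈ range P.curve
  swap
  · exact subset_closure hx
  obtain ⟨z, rfl⟩ := hx
  refine mem_closure_iff_nhds.2 fun U hU => ?_
  by_cases hz : P.IsDouble z
  · obtain ⟨e, he⟩ := P.exists_crossChart ⟨_, hz.mem_crossings⟩
    have hU' : ∀ᶠ q in 𝓝 0, e q ∈ U :=
      he.1.continuous.continuousAt.preimage_mem_nhds (he.2.1 ▸ hU)
    obtain ⟨q, hq, hqU⟩ := exists_mem_quadrant (true, true) hU'
    exact ⟨e q, hqU, he.notMem hq⟩
  · obtain ⟨e, he⟩ := exists_arcChart hz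
    have hU' : ∀ᶠ q in 𝓝 0, e q ∈ U :=
      he.1.continuous.continuousAt.preimage_mem_nhds (he.2.1 ▸ hU)
    obtain ⟨q, hq, hqU⟩ := exists_pos_of_eventually rfl hU'
    exact ⟨e q, hqU, fun h => hq.ne' ((Set.ext_iff.1 he.2.2 q).1 h)⟩

/-! ### Jumps as relations between the dual classes -/

variable [ChartedSpace (EuclideanSpace ℝ (Fin 2)) X]

/-- A relation provides a function off a finite set with the prescribed jumps. The exceptional
points are removable, and passing to the local almost everywhere values makes the function locally
constant off the projection. -/
theorem exists_mem_jumpSpace_of_ker {j : Fin n → ZMod 2} (hj : j ∈ LinearMap.ker P.classMap) :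
    ∃ f, (f, j) ∈ P.jumpSpace := by
  classical
  have hL := isLocalFilter_denseInterior (X := X)
  obtain ⟨S, hS, f₀, hf₀⟩ := mem_ker_classMap.1 hj
  have hoff : ∀ p ∉ range P.curve, EvConst (denseInterior X) p f₀ := by
    intro p hp
    refine EvConst.of_punctured ?_
    filter_upwards [hS.eventually_punctured_notMem p,
      nhdsWithin_le_nhds (P.isClosed_range.isOpen_compl.mem_nhds hp)] with x hx hx'
    have := hf₀ x hx
    rwa [sum_componentPotential_of_notMem j hx', sub_zero] at this
  choose! c hc using hoff
  let f : X → ZMod 2 := fun p => if p ∈ range P.curve then 0 else c p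
  have hfc : ∀ p ∉ range P.curve, ∀ᶠ y in 𝓝 p, f y = c p := by
    intro p hp
    filter_upwards [P.isClosed_range.isOpen_compl.mem_nhds hp,
      eventually_nhds_eventually_inf (hc p hp)] with y hy hy'
    simp only [f, if_neg hy]
    exact hL.const_unique (hc y hy) hy'
  have hf : LocConstOff (range P.curve) f := by
    intro p hp
    filter_upwards [hfc p hp] with y hy
    rw [hy, (hfc p hp).self_of_nhds]
  have hff₀ : ∀ᶠ y in denseInterior X, f₀ y = f y := by
    have h := hL.of_forall _ (fun y => f₀ y = f y) P.isClosed_range.isOpen_compl fun p hp => by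
      filter_upwards [hc p hp, (hfc p hp).filter_mono inf_le_left] with y h h'
      rw [h, h']
    filter_upwards [h, P.compl_range_mem_denseInterior] with y hy hy'
    exact hy hy'
  refine ⟨f, fun p hp => if_pos hp, hf, fun z hz => ?_⟩
  obtain ⟨e, he, hs⟩ := exists_side_eq hz
  have hax : ∀ q, e q ∈ range P.curve ↔ q.2 = 0 := Set.ext_iff.1 he.2.2
  -- Near a regular point only its own component passes, so only the coefficient `j z.1` enters.
  have hcomp : ∀ᶠ x in 𝓝 (P.curve z), ∀ v, P.curve v = x → v.1 = z.1 := by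
    refine P.eventually_fiber (N := {v | v.1 = z.1}) fun v hv => ?_
    obtain rfl : v = z := by
      by_contra h
      exact hz ⟨v, h, hv⟩
    exact continuous_fst.continuousAt.preimage_mem_nhds ((isOpen_discrete {v.1}).mem_nhds rfl)
  rw [hs]
  refine EvConst.of_punctured ?_
  filter_upwards [hS.eventually_punctured_notMem _,
    Set.Finite.eventually_punctured_notMem P.finite_double _, nhdsWithin_le_nhds hcomp,
    nhdsWithin_le_nhds (he.1.isOpen_range.mem_nhds ⟨0, he.2.1⟩)] with x hxS hxc hx hxe
  obtain ⟨q, rfl⟩ := hxe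
  by_cases hxr : e q ∈ range P.curve
  · obtain ⟨v, hv⟩ := hxr
    have hd : ¬ P.IsDouble v := fun h => hxc (hv ▸ h.mem_crossings)
    have h := hf₀ _ hxS
    rw [← hv, sum_componentPotential j hd, hx v hv] at h
    have h' := EvConst.sub_smul_congr h
      (side_compat hd he.1 hv.symm ((hax q).1 ⟨v, hv⟩) (.of_forall hax))
    rw [hv] at h'
    refine h'.congr ?_
    filter_upwards [mem_inf_of_right hff₀] with y hy
    simp only [Pi.sub_apply, hy]
  · have h₁ := evConst_upperSide he.1 fun h => hxr ((hax q).2 h)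
    obtain ⟨a, ha⟩ := LocConstOff.evConst hf hxr
    obtain ⟨b, hb⟩ := h₁
    refine ⟨a - j z.1 * b, ?_⟩
    filter_upwards [ha, hb] with y h h'
    simp [h, h']

theorem map_snd_jumpSpace :
    P.jumpSpace.map (LinearMap.snd _ _ _) = LinearMap.ker P.classMap := by
  ext j
  constructor
  · rintro ⟨⟨f, j⟩, ⟨h0, hf, hj⟩, rfl⟩
    refine mem_ker_classMap.2 ⟨P.crossings, P.finite_double, f, fun p hp => ?_⟩
    by_cases hpr : p ∈ range P.curve
    · obtain ⟨z, rfl⟩ := hpr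
      have hz : ¬ P.IsDouble z := fun h => hp h.mem_crossings
      rw [sum_componentPotential _ hz]
      exact hj z hz
    · rw [sum_componentPotential_of_notMem _ hpr, sub_zero]
      exact LocConstOff.evConst hf hpr
  · intro hj
    obtain ⟨f, hf⟩ := exists_mem_jumpSpace_of_ker hj
    exact ⟨_, hf, rfl⟩

/-- Without jumps the function is almost everywhere constant near every regular point of the
projection, the crossings are removable, and the surface is connected. -/
theorem eq_of_jump_zero [ConnectedSpace X] {f : X → ZMod 2} (hf : (f, 0) ∈ P.jumpSpace) :
    ∃ c, ∀ p ∉ range P.curve, f p = c := by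
  have hL := isLocalFilter_denseInterior (X := X)
  have h₁ : ∀ p ∉ P.crossings, EvConst (denseInterior X) p f := by
    intro p hp
    by_cases hpr : p ∈ range P.curve
    · obtain ⟨z, rfl⟩ := hpr
      simpa using hf.2.2 z fun h => hp h.mem_crossings
    · exact LocConstOff.evConst hf.2.1 hpr
  have h₂ : ∀ p, EvConst (denseInterior X) p f := fun p =>
    EvConst.of_punctured ((Set.Finite.eventually_punctured_notMem P.finite_double p).mono h₁)
  obtain ⟨c, hc⟩ := hL.exists_const isPreconnected_univ fun p _ => h₂ p
  refine ⟨c, fun p hp => ?_⟩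
  exact hL.const_unique ((hf.2.1 p hp).filter_mono inf_le_left) (hc p trivial)

/-- Rank-nullity for the map that records the jumps: its image is the space of relations, and its
kernel is spanned by the indicator function `u` of the complement of the projection. -/
theorem finrank_evenSpace [CompactSpace X] [ConnectedSpace X] :
    Module.finrank (ZMod 2) (evenSpace (range P.curve) P.crossings) =
      Module.finrank (ZMod 2) (LinearMap.ker P.classMap) + 1 := by
  classical
  have := P.finite_evenSpace
  have : Module.Finite (ZMod 2) P.jumpSpace := Module.Finite.equiv P.jumpSpaceEquiv.symm
  rw [← P.jumpSpaceEquiv.finrank_eq,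
    ← LinearMap.finrank_range_add_finrank_ker ((LinearMap.snd _ _ _).domRestrict P.jumpSpace),
    LinearMap.range_domRestrict, map_snd_jumpSpace, add_right_inj]
  let u : X → ZMod 2 := (range P.curve)ᶜ.indicator 1
  have hu1 : ∀ p ∉ range P.curve, u p = 1 := fun p hp =>
    indicator_of_mem (s := (range P.curve)ᶜ) hp _
  have hu0 : ∀ p ∈ range P.curve, u p = 0 := fun p hp =>
    indicator_of_notMem (s := (range P.curve)ᶜ) (not_not.2 hp) _
  have hu : (u, 0) ∈ P.jumpSpace := by
    refine ⟨hu0, fun p hp => ?_, fun z _ => ?_⟩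
    · filter_upwards [P.isClosed_range.isOpen_compl.mem_nhds hp] with y hy
      rw [hu1 p hp, hu1 y hy]
    · refine ⟨1, ?_⟩
      filter_upwards [mem_inf_of_right P.compl_range_mem_denseInterior] with y hy
      simp [hu1 y hy]
  let v : LinearMap.ker ((LinearMap.snd (ZMod 2) (X → ZMod 2) (Fin n → ZMod 2)).domRestrict
    P.jumpSpace) := ⟨⟨(u, 0), hu⟩, rfl⟩
  refine (finrank_eq_one_iff' (K := ZMod 2)).2 ⟨v, ?_, ?_⟩
  · intro h
    have h' : u = 0 := congrArg Prod.fst (congrArg Subtype.val (congrArg Subtype.val h))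
    have hd : Dense (range P.curve)ᶜ := by
      have := P.compl_range_mem_denseInterior
      rwa [mem_denseInterior, P.isClosed_range.isOpen_compl.interior_eq] at this
    obtain ⟨p, hp⟩ := hd.nonempty
    have := hu1 p hp
    rw [h'] at this
    exact zero_ne_one this
  · rintro ⟨⟨⟨f, j⟩, hf⟩, hj⟩
    obtain rfl : j = 0 := hj
    obtain ⟨c, hc⟩ := eq_of_jump_zero hf
    refine ⟨c, Subtype.ext (Subtype.ext (Prod.ext (funext fun p => ?_) (smul_zero c)))⟩
    change c * u p = f p
    by_cases hp : p ∈ range P.curve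
    · rw [hu0 p hp, mul_zero]
      exact (hf.1 p hp).symm
    · rw [hu1 p hp, mul_one, hc p hp]

end JumpSpace

end LinkProjection

/-! ### Homotopy invariance -/

namespace LinkProjection

variable {n : ℕ} {X : Type*} [TopologicalSpace X]

/-- The same projection with another numbering and parametrization of the components. -/
noncomputable def reparam (P : LinkProjection n X) (h : Circles n ≃ₜ Circles n) :
    LinkProjection n X where
  curve := P.curve.comp (h : C(Circles n, Circles n))
  regular z hz := by
    have hr : range (P.curve.comp (h : C(Circles n, Circles n))) = range P.curve :=
      h.surjective.range_comp P.curve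
    rw [hr]
    refine P.regular (h z) fun w hw => ?_
    rw [← h.apply_symm_apply w]
    exact congrArg h (hz _ (by simpa using hw))
  double z w v hzw hwv := by
    simpa using P.double (h z) (h w) (h v) hzw hwv
  transverse z w hzw hc := by
    have hr : range (P.curve.comp (h : C(Circles n, Circles n))) = range P.curve :=
      h.surjective.range_comp P.curve
    obtain ⟨e, he, hz, hw⟩ := P.transverse (h z) (h w) (h.injective.ne hzw) hc
    rw [hr]
    exact ⟨e, he, h.continuous.continuousAt.eventually hz, h.continuous.continuousAt.eventually hw⟩
  finite_double := by
    refine P.finite_double.subset ?_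
    rintro p ⟨z, w, hzw, hz, hw⟩
    exact ⟨h z, h w, h.injective.ne hzw, hz, hw⟩

theorem range_reparam (P : LinkProjection n X) (h : Circles n ≃ₜ Circles n) :
    range (P.reparam h).curve = range P.curve :=
  h.surjective.range_comp P.curve

theorem crossings_reparam (P : LinkProjection n X) (h : Circles n ≃ₜ Circles n) :
    (P.reparam h).crossings = P.crossings := by
  ext p
  constructor
  · rintro ⟨z, w, hzw, hz, hw⟩
    exact ⟨h z, h w, h.injective.ne hzw, hz, hw⟩
  · rintro ⟨z, w, hzw, hz, hw⟩
    refine ⟨h.symm z, h.symm w, h.symm.injective.ne hzw, ?_, ?_⟩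
    · simpa [reparam] using hz
    · simpa [reparam] using hw

/-- The defect depends only on `classMap`, and renumbering or reparametrizing changes neither the
image of the projection nor its crossings. -/
theorem regionDefect_eq_of_homotopic [T2Space X] [CompactSpace X] [ConnectedSpace X]
    [ChartedSpace (EuclideanSpace ℝ (Fin 2)) X] {P Q : LinkProjection n X} (h : P.Homotopic Q) :
    P.regionDefect = Q.regionDefect := by
  obtain ⟨k, hk⟩ := h
  have hclass : P.classMap = (Q.reparam k).classMap := by
    unfold classMap
    congr 1
    funext i
    exact componentPotential_homotopic (P' := Q.reparam k) hk i
  rw [P.regionDefect_eq, Q.regionDefect_eq, P.finrank_evenSpace, hclass,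
    ← (Q.reparam k).finrank_evenSpace, range_reparam, crossings_reparam]

end LinkProjection

/-! ### Reidemeister moves as homotopies -/

namespace LinkDiagram

variable {n : ℕ} {X : Type*} [TopologicalSpace X]

/-- A change inside a disc does not change the homotopy class. -/
theorem LocalMove.homotopic [T2Space X] {k : ℕ} {T T' : Fin k → ℝ → ℝ × ℝ}
    {L L' : LinkDiagram n X} (hm : LocalMove T T' L L') :
    L.toLinkProjection.Homotopic L'.toLinkProjection := by
  classical
  obtain ⟨e, h, a, ht, he, -, -, hin, hin', -, -, -, -, hout⟩ := hm
  refine ⟨h, ?_⟩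
  let B : Set (ℝ × ℝ) := Icc (-1) 1 ×ˢ Icc (-1) 1
  let A : Set (Circles n) := {z | L.curve z ∈ e '' B}
  have hBcl : IsClosed (e '' B) := ((isCompact_Icc.prod isCompact_Icc).image he.continuous).isClosed
  have hA : IsClosed A := hBcl.preimage L.curve.continuous
  have hA' : ∀ z ∈ A, L'.curve (h z) ∈ e '' B := fun z hz => (hin' z).2 ((hin z).1 hz)
  have hAc : ∀ z ∉ A, L'.curve (h z) = L.curve z := fun z hz =>
    (hout z fun h' => hz ((hin z).2 h')).1
  -- The two curves agree off the closed set `A`, hence by continuity on its frontier, where the two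
  -- formulas for the homotopy must match.
  have hfr : ∀ z ∈ frontier A, L'.curve (h z) = L.curve z := by
    intro z hz
    rw [frontier_eq_closure_inter_closure] at hz
    have hcl : IsClosed {z | L'.curve (h z) = L.curve z} :=
      isClosed_eq (L'.curve.continuous.comp h.continuous) L.curve.continuous
    exact hcl.closure_subset_iff.2 (fun z hz => hAc z hz) hz.2
  let E := he.toOpenPartialHomeomorph e
  have hE : ∀ q, E.symm (e q) = q := fun q => E.left_inv (by simp [E])
  have hE' : ∀ x ∈ e '' B, e (E.symm x) = x := by
    rintro _ ⟨q, -, rfl⟩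
    rw [hE]
  have hEc : ContinuousOn E.symm (e '' B) := E.continuousOn_symm.mono (by
    rintro _ ⟨q, -, rfl⟩
    simp [E])
  -- The straight-line homotopy in the coordinates of the disc; outside, nothing moves. The shapes
  -- of the strands play no role.
  let F : unitInterval × Circles n → X := fun y =>
    if y.2 ∈ A then e ((1 - (y.1 : ℝ)) • E.symm (L.curve y.2) +
      (y.1 : ℝ) • E.symm (L'.curve (h y.2))) else L.curve y.2
  have hF : Continuous F := by
    refine continuous_if ?_ ?_ ?_
    · rintro ⟨s, z⟩ hz
      have hz' : z ∈ frontier A := continuous_snd.frontier_preimage_subset A hz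
      have hzA : z ∈ A := hA.frontier_subset hz'
      simp only [hfr z hz', ← add_smul, sub_add_cancel, one_smul]
      exact hE' _ hzA
    · have hcl : closure {y : unitInterval × Circles n | y.2 ∈ A} = {y | y.2 ∈ A} :=
        (hA.preimage continuous_snd).closure_eq
      rw [hcl]
      refine he.continuous.comp_continuousOn ?_
      have h₁ : ContinuousOn (fun y : unitInterval × Circles n => E.symm (L.curve y.2))
          {y | y.2 ∈ A} :=
        hEc.comp (L.curve.continuous.comp continuous_snd).continuousOn fun y hy => hy
      have h₂ : ContinuousOn (fun y : unitInterval × Circles n => E.symm (L'.curve (h y.2)))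
          {y | y.2 ∈ A} :=
        hEc.comp (L'.curve.continuous.comp (h.continuous.comp continuous_snd)).continuousOn
          fun y hy => hA' _ hy
      fun_prop
    · exact (L.curve.continuous.comp continuous_snd).continuousOn
  refine ⟨⟨⟨F, hF⟩, fun z => ?_, fun z => ?_⟩⟩
  · by_cases hz : z ∈ A
    · simp [F, hz, hE' _ hz]
    · simp [F, hz]
  · by_cases hz : z ∈ A
    · simp [F, hz, hE' _ (hA' z hz)]
    · simp [F, hz, hAc z hz]

end LinkDiagram

theorem theorem3 {X : Type*} [TopologicalSpace X] [T2Space X] [CompactSpace X] [ConnectedSpace X]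
    [ChartedSpace (EuclideanSpace ℝ (Fin 2)) X] {n : ℕ} (L L' : LinkDiagram n X) :
    Finite L.Region ∧
    (L.ReidemeisterOne L' → L.regionDefect = L'.regionDefect) ∧
    (L.ReidemeisterTwo L' → L.regionDefect = L'.regionDefect) ∧
    (L.ReidemeisterThree L' → L.regionDefect = L'.regionDefect) ∧
    (L.toLinkProjection.Homotopic L'.toLinkProjection → L.regionDefect = L'.regionDefect) :=
  ⟨L.toLinkProjection.finite_region,
    fun h => LinkProjection.regionDefect_eq_of_homotopic (LinkDiagram.LocalMove.homotopic h),
    fun h => LinkProjection.regionDefect_eq_of_homotopic (LinkDiagram.LocalMove.homotopic h),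
    fun h => LinkProjection.regionDefect_eq_of_homotopic (LinkDiagram.LocalMove.homotopic h),
    LinkProjection.regionDefect_eq_of_homotopic⟩
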